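/- Let $a<b$ and let $u\in C^\infty[a,b]$ be a real-valued solution of $u'(t)=f(t,u(t))$, $a\le t\le b$, where $f$ is a real-valued $C^\infty$ function on an open set $\Omega\subseteq\mathbb R^2$ containing the graph $\{(t,u(t)) : t\in[a,b]\}$. For real coefficients $c_j,a_{jk},w_j$ and real numbers $\varepsilon_2^2,\varepsilon_3^2,\varepsilon_4^2$ (squared shape parameters, which are allowed to be negative), the four-stage MQ-RBF-based Runge–Kutta method with step $h>0$ is $v\mapsto v+h\sum_{j=1}^4 w_jK_j$, where $K_1=f(t,v)$ and, for $j=2,3,4$, $$K_j=f\Big(t+c_jh,\ \big(1+\tfrac{\varepsilon_j^2(c_jh)^2}{2}\big)\big(v+h\sum_{k<j}a_{jk}K_k\big)\Big).$$ Its local truncation error at time $t$ is $\tau(t,h)=\frac{u(t+h)-u(t)}{h}-\sum_{j=1}^4 w_jK_j$, with the $K_j$ evaluated at $v=u(t)$. Consider the following two coefficient sets, in which $\varepsilon_2^2=x\in\mathbb R$ is the only free parameter. **C1.** $a_{21}=c_2=\frac25$, $c_3=\frac35$, $c_4=1$, $a_{31}=-\frac3{20}$, $a_{32}=\frac34$,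 $a_{41}=\frac{19}{44}$, $a_{42}=-\frac{15}{44}$, $a_{43}=\frac{10}{11}$, $w_1=w_4=\frac{11}{72}$, $w_2=w_3=\frac{25}{72}$, $\varepsilon_3^2=-\frac23x$, $\varepsilon_4^2=\frac2{11}x$, with $$\alpha=168f_{uu}u^2,$$ $$\beta=(66f_{ttu}+66f_{uuu}f^2+132f_{tuu}f-462f_{tu}f_u-270f_{uu}f_t-732f_{uu}f_uf+330f_u^3)u+132f^2f_{uu}-402f_u^2f+132f_{tu}f-270f_tf_u,$$ $$\gamma=11(f_{tttt}+f_{uuuu}f^4+4f_{tttu}f+4f_{tuuu}f^3+6f_{ttuu}f^2)-44(f_{ttt}f_u+3f_{ttu}f_uf+3f_uf_{tuu}f^2+f_uf_{uuu}f^3)$$ $$\qquad+330f_tf_{tu}f_u+330f_{tu}f_u^2f+135f_t^2f_{uu}+600f_tf_uf_{uu}f+465f_u^2f_{uu}f^2-330f_u^3u''.$$ **C2.** $a_{21}=c_2=\frac14$, $c_3=\frac35$, $c_4=1$, $a_{31}=-\frac6{25}$, $a_{32}=\frac{21}{25}$, $a_{41}=\frac65$, $a_{42}=-\frac{57}{35}$,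 $a_{43}=\frac{10}7$, $w_1=\frac19$, $w_2=\frac{16}{63}$, $w_3=\frac{125}{252}$, $w_4=\frac5{36}$, $\varepsilon_3^2=-\frac16x$, $\varepsilon_4^2=\frac1{10}x$, with $$\alpha=3f_{uu}u^2,$$ $$\beta=6(f_{ttu}+f^2f_{uuu}+2f_{tuu}f-7f_{tu}f_u-7f_{uu}f_uf+5f_u^3)u+12(f_{uu}f^2-f_u^2f+f_{tu}f),$$ $$\gamma=f_{tttt}+4f_{tttu}f+6f_{ttuu}f^2+4f_{tuuu}f^3+f_{uuuu}f^4-4(f_{ttt}+3f_{ttu}f+3f_{tuu}f^2+f_{uuu}f^3)f_u+18f_{tt}f_{tu}+18f_{tt}f_{uu}f$$ $$\qquad+18f_{uu}^2f^3+36f_{tu}^2f+54f_{tu}f_{uu}f^2+30f_{uu}f_u^2f^2+48f_{uu}f_tf_uf+48f_{tu}f_tf_u+12f_{tu}f_u^2f-18f_{tt}f_u^2-48f_u^3u''.$$ Here $f$ and its partial derivatives are evaluated at $(t,u(t))$, and $u,u''$ at $t$. For each of C1 and C2 the following hold. 1. (Fifth order.) For every $M$ there are $C$ and $h_0>0$ such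 that $|\tau(t,h)|\le Ch^5$ whenever $t\in[a,b]$, $0<h\le h_0$, $t+h\le b$, $|x|\le M$, and $x$ is a real root of $\alpha x^2+\beta x+\gamma=0$ at $t$. 2. (At least fourth order.) For every $M$ there are $C$ and $h_0>0$ such that $|\tau(t,h)|\le Ch^4$ whenever $t\in[a,b]$, $0<h\le h_0$, $t+h\le b$ and $|x|\le M$, whether or not $x$ is a root. 3. (Otherwise exactly fourth order.) If $t\in[a,b)$ and $x\in\mathbb R$ does not satisfy $\alpha x^2+\beta x+\gamma=0$ at $t$, then $\tau(t,h)$ is not $O(h^5)$ as $h\to0^+$. -/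

import Mathlib

open Set Filter Topology Asymptotics
open scoped ContDiff

noncomputable section

namespace MQRBF

/-- Coefficients of a four-stage explicit MQ-RBF-based Runge-Kutta method. The shape parameters
enter the method only through their squares `ε₂², ε₃², ε₄²`, which are arbitrary real numbers
(possibly negative); `r3` and `r4` are the fixed multiples `ε₃² = r3 * ε₂²`, `ε₄² = r4 * ε₂²`. -/
structure Coeffs where
  c2 : ℝ
  c3 : ℝ
  c4 : ℝ
  a21 : ℝ
  a31 : ℝ
  a32 : ℝ
  a41 : ℝ
  a42 : ℝ
  a43 : ℝ
  w1 : ℝ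
  w2 : ℝ
  w3 : ℝ
  w4 : ℝ
  r3 : ℝ
  r4 : ℝ

/-- The coefficient set C1. -/
def C1 : Coeffs where
  c2 := 2 / 5
  c3 := 3 / 5
  c4 := 1
  a21 := 2 / 5
  a31 := -3 / 20
  a32 := 3 / 4
  a41 := 19 / 44
  a42 := -15 / 44
  a43 := 10 / 11
  w1 := 11 / 72
  w2 := 25 / 72
  w3 := 25 / 72
  w4 := 11 / 72
  r3 := -2 / 3
  r4 := 2 / 11

/-- The coefficient set C2. -/
def C2 : Coeffs where
  c2 := 1 / 4
  c3 := 3 / 5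
  c4 := 1
  a21 := 1 / 4
  a31 := -6 / 25
  a32 := 21 / 25
  a41 := 6 / 5
  a42 := -57 / 35
  a43 := 10 / 7
  w1 := 1 / 9
  w2 := 16 / 63
  w3 := 125 / 252
  w4 := 5 / 36
  r3 := -1 / 6
  r4 := 1 / 10

variable (A : Coeffs) (f : ℝ → ℝ → ℝ)

/-- First stage slope at time `t` and value `v`. -/
def K1 (t v : ℝ) : ℝ := f t v

/-- Second stage slope with step `h`, where `x` is the value of `ε₂²`. -/
def K2 (t v h x : ℝ) : ℝ :=
  f (t + A.c2 * h) ((1 + x * (A.c2 * h) ^ 2 / 2) * (v + h * (A.a21 * K1 f t v)))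

/-- Third stage slope with step `h`, where `x` is the value of `ε₂²`. -/
def K3 (t v h x : ℝ) : ℝ :=
  f (t + A.c3 * h) ((1 + (A.r3 * x) * (A.c3 * h) ^ 2 / 2) *
    (v + h * (A.a31 * K1 f t v + A.a32 * K2 A f t v h x)))

/-- Fourth stage slope with step `h`, where `x` is the value of `ε₂²`. -/
def K4 (t v h x : ℝ) : ℝ :=
  f (t + A.c4 * h) ((1 + (A.r4 * x) * (A.c4 * h) ^ 2 / 2) *
    (v + h * (A.a41 * K1 f t v + A.a42 * K2 A f t v h x + A.a43 * K3 A f t v h x)))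

/-- The weighted average of the slopes: one step of the method is
`v ↦ v + h * increment A f t v h x`. -/
def increment (t v h x : ℝ) : ℝ :=
  A.w1 * K1 f t v + A.w2 * K2 A f t v h x + A.w3 * K3 A f t v h x + A.w4 * K4 A f t v h x

/-- The local truncation error at time `t`, with step `h` and `ε₂² = x`, along the exact
solution `u` (normalised by the step size). -/
def localTruncationError (u : ℝ → ℝ) (t h x : ℝ) : ℝ :=
  (u (t + h) - u t) / h - increment A f t (u t) h x

/-- The local truncation error is `O(h ^ p)` on `[a, b]` for all shape parameters `ε₂² = x`
that are admissible at `t`, uniformly in `t` and locally uniformly in `x`. -/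
def HasAccuracy (u : ℝ → ℝ) (a b : ℝ) (admissible : ℝ → ℝ → Prop) (p : ℕ) : Prop :=
  ∀ M : ℝ, ∃ C : ℝ, ∃ h₀ : ℝ, 0 < h₀ ∧ ∀ t h x : ℝ,
    a ≤ t → 0 < h → h ≤ h₀ → t + h ≤ b → |x| ≤ M → admissible t x →
      |localTruncationError A f u t h x| ≤ C * h ^ p

/-- The partial derivative `∂ₜ^i ∂ᵤ^j f` at `(t, v)`. -/
def pd (i j : ℕ) (t v : ℝ) : ℝ :=
  iteratedDeriv i (fun s => iteratedDeriv j (fun w => f s w) v) t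

/-- The values of `f` and its partial derivatives of order at most four at a point `(t, u(t))` of
the solution curve (those that occur in the quadratic equations), together with the values
`u(t)` and `u''(t)`. -/
structure Jet where
  f : ℝ
  ft : ℝ
  fu : ℝ
  ftt : ℝ
  ftu : ℝ
  fuu : ℝ
  fttt : ℝ
  fttu : ℝ
  ftuu : ℝ
  fuuu : ℝ
  ftttt : ℝ
  ftttu : ℝ
  fttuu : ℝ
  ftuuu : ℝ
  fuuuu : ℝ
  u : ℝ
  u'' : ℝ

/-- The jet of `f` along the solution `u` on `[a, b]` at time `t`. -/
def jet (u : ℝ → ℝ) (a b t : ℝ) : Jet where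
  f := f t (u t)
  ft := pd f 1 0 t (u t)
  fu := pd f 0 1 t (u t)
  ftt := pd f 2 0 t (u t)
  ftu := pd f 1 1 t (u t)
  fuu := pd f 0 2 t (u t)
  fttt := pd f 3 0 t (u t)
  fttu := pd f 2 1 t (u t)
  ftuu := pd f 1 2 t (u t)
  fuuu := pd f 0 3 t (u t)
  ftttt := pd f 4 0 t (u t)
  ftttu := pd f 3 1 t (u t)
  fttuu := pd f 2 2 t (u t)
  ftuuu := pd f 1 3 t (u t)
  fuuuu := pd f 0 4 t (u t)
  u := u t
  u'' := iteratedDerivWithin 2 u (Icc a b) t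

/-- The coefficient `α` of the quadratic equation for C1. -/
def alpha1 (J : Jet) : ℝ := 168 * J.fuu * J.u ^ 2

/-- The coefficient `β` of the quadratic equation for C1. -/
def beta1 (J : Jet) : ℝ :=
  (66 * J.fttu + 66 * J.fuuu * J.f ^ 2 + 132 * J.ftuu * J.f - 462 * J.ftu * J.fu
      - 270 * J.fuu * J.ft - 732 * J.fuu * J.fu * J.f + 330 * J.fu ^ 3) * J.u
    + 132 * J.f ^ 2 * J.fuu - 402 * J.fu ^ 2 * J.f + 132 * J.ftu * J.f - 270 * J.ft * J.fu

/-- The coefficient `γ` of the quadratic equation for C1. -/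
def gamma1 (J : Jet) : ℝ :=
  11 * (J.ftttt + J.fuuuu * J.f ^ 4 + 4 * J.ftttu * J.f + 4 * J.ftuuu * J.f ^ 3
      + 6 * J.fttuu * J.f ^ 2)
    - 44 * (J.fttt * J.fu + 3 * J.fttu * J.fu * J.f + 3 * J.fu * J.ftuu * J.f ^ 2
      + J.fu * J.fuuu * J.f ^ 3)
    + 330 * J.ft * J.ftu * J.fu + 330 * J.ftu * J.fu ^ 2 * J.f + 135 * J.ft ^ 2 * J.fuu
    + 600 * J.ft * J.fu * J.fuu * J.f + 465 * J.fu ^ 2 * J.fuu * J.f ^ 2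
    - 330 * J.fu ^ 3 * J.u''

/-- The coefficient `α` of the quadratic equation for C2. -/
def alpha2 (J : Jet) : ℝ := 3 * J.fuu * J.u ^ 2

/-- The coefficient `β` of the quadratic equation for C2. -/
def beta2 (J : Jet) : ℝ :=
  6 * (J.fttu + J.f ^ 2 * J.fuuu + 2 * J.ftuu * J.f - 7 * J.ftu * J.fu
      - 7 * J.fuu * J.fu * J.f + 5 * J.fu ^ 3) * J.u
    + 12 * (J.fuu * J.f ^ 2 - J.fu ^ 2 * J.f + J.ftu * J.f)

/-- The coefficient `γ` of the quadratic equation for C2. -/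
def gamma2 (J : Jet) : ℝ :=
  J.ftttt + 4 * J.ftttu * J.f + 6 * J.fttuu * J.f ^ 2 + 4 * J.ftuuu * J.f ^ 3
    + J.fuuuu * J.f ^ 4
    - 4 * (J.fttt + 3 * J.fttu * J.f + 3 * J.ftuu * J.f ^ 2 + J.fuuu * J.f ^ 3) * J.fu
    + 18 * J.ftt * J.ftu + 18 * J.ftt * J.fuu * J.f + 18 * J.fuu ^ 2 * J.f ^ 3
    + 36 * J.ftu ^ 2 * J.f + 54 * J.ftu * J.fuu * J.f ^ 2 + 30 * J.fuu * J.fu ^ 2 * J.f ^ 2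
    + 48 * J.fuu * J.ft * J.fu * J.f + 48 * J.ftu * J.ft * J.fu
    + 12 * J.ftu * J.fu ^ 2 * J.f - 18 * J.ftt * J.fu ^ 2 - 48 * J.fu ^ 3 * J.u''

/-- `x` is a root of the quadratic equation of C1 at time `t`. -/
def IsRoot1 (u : ℝ → ℝ) (a b t x : ℝ) : Prop :=
  alpha1 (jet f u a b t) * x ^ 2 + beta1 (jet f u a b t) * x + gamma1 (jet f u a b t) = 0

/-- `x` is a root of the quadratic equation of C2 at time `t`. -/
def IsRoot2 (u : ℝ → ℝ) (a b t x : ℝ) : Prop :=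
  alpha2 (jet f u a b t) * x ^ 2 + beta2 (jet f u a b t) * x + gamma2 (jet f u a b t) = 0

end MQRBF

end

namespace MQRBF

/-! ### Partial derivatives of a smooth function of two variables -/

/-! Both the increment of the method and the difference quotient of `u` have expansions in powers of
`h` whose coefficients are universal polynomials in the partial derivatives of `f` at `(t, u t)`, in
`u t` and, for the method, in `x`. For C1 and C2 they agree through `h³` (`isFourthOrder_C1`,
`isFourthOrder_C2`). Once `u'' = f_t + f_u f` is substituted, the difference of the `h⁴`
coefficients, `errorCoeff`, is a nonzero constant times the quadratic of the statement
(`errorCoeff_C1`, `errorCoeff_C2`). Hence `τ = errorCoeff * h⁴ + O(h⁵)`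
(`localTruncationError_sub_le`), and the three claims correspond to this coefficient being zero,
bounded or nonzero.

Uniformity in `t` and `x` comes from compactness of the graph of `u`. It is carried by a filter on
triples `(t, h, x)`, along which ordinary big-O calculus is already uniform. `Expands.comp` expands
`f` along a perturbed point, which handles the stages; `solution_sub_taylor_isBigO` handles the
exact solution, using only the first-order equation. -/

theorem hasDerivAt_snd_of_contDiffOn {g : ℝ → ℝ → ℝ} {Ω : Set (ℝ × ℝ)} (hΩ : IsOpen Ω)
    (hg : ContDiffOn ℝ ∞ (fun p : ℝ × ℝ => g p.1 p.2) Ω) {p : ℝ × ℝ} (hp : p ∈ Ω) :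
    HasDerivAt (fun w => g p.1 w) (fderiv ℝ (fun p : ℝ × ℝ => g p.1 p.2) p (0, 1)) p.2 := by
  have h1 : HasFDerivAt (fun p : ℝ × ℝ => g p.1 p.2) (fderiv ℝ (fun p : ℝ × ℝ => g p.1 p.2) p)
      (p.1, p.2) :=
    ((hg.contDiffAt (hΩ.mem_nhds hp)).differentiableAt (by simp)).hasFDerivAt
  have h2 : HasDerivAt (fun w : ℝ => (p.1, w)) ((0 : ℝ), (1 : ℝ)) p.2 :=
    (hasDerivAt_const p.2 p.1).prodMk (hasDerivAt_id p.2)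
  exact h1.comp_hasDerivAt p.2 h2

theorem hasDerivAt_fst_of_contDiffOn {g : ℝ → ℝ → ℝ} {Ω : Set (ℝ × ℝ)} (hΩ : IsOpen Ω)
    (hg : ContDiffOn ℝ ∞ (fun p : ℝ × ℝ => g p.1 p.2) Ω) {p : ℝ × ℝ} (hp : p ∈ Ω) :
    HasDerivAt (fun s => g s p.2) (fderiv ℝ (fun p : ℝ × ℝ => g p.1 p.2) p (1, 0)) p.1 := by
  have h1 : HasFDerivAt (fun p : ℝ × ℝ => g p.1 p.2) (fderiv ℝ (fun p : ℝ × ℝ => g p.1 p.2) p)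
      (p.1, p.2) :=
    ((hg.contDiffAt (hΩ.mem_nhds hp)).differentiableAt (by simp)).hasFDerivAt
  have h2 : HasDerivAt (fun s : ℝ => (s, p.2)) ((1 : ℝ), (0 : ℝ)) p.1 :=
    (hasDerivAt_id p.1).prodMk (hasDerivAt_const p.1 p.2)
  exact h1.comp_hasDerivAt p.1 h2

theorem contDiffOn_fderiv_apply {F : ℝ × ℝ → ℝ} {Ω : Set (ℝ × ℝ)} (hΩ : IsOpen Ω)
    (hF : ContDiffOn ℝ ∞ F Ω) (e : ℝ × ℝ) : ContDiffOn ℝ ∞ (fun p => fderiv ℝ F p e) Ω :=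
  (hF.fderiv_of_isOpen hΩ (by simp)).clm_apply contDiffOn_const

theorem contDiffOn_deriv_snd {g : ℝ → ℝ → ℝ} {Ω : Set (ℝ × ℝ)} (hΩ : IsOpen Ω)
    (hg : ContDiffOn ℝ ∞ (fun p : ℝ × ℝ => g p.1 p.2) Ω) :
    ContDiffOn ℝ ∞ (fun p : ℝ × ℝ => deriv (fun w => g p.1 w) p.2) Ω :=
  (contDiffOn_fderiv_apply hΩ hg (0, 1)).congr
    fun _ hp => (hasDerivAt_snd_of_contDiffOn hΩ hg hp).deriv

theorem contDiffOn_deriv_fst {g : ℝ → ℝ → ℝ} {Ω : Set (ℝ × ℝ)} (hΩ : IsOpen Ω)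
    (hg : ContDiffOn ℝ ∞ (fun p : ℝ × ℝ => g p.1 p.2) Ω) :
    ContDiffOn ℝ ∞ (fun p : ℝ × ℝ => deriv (fun s => g s p.2) p.1) Ω :=
  (contDiffOn_fderiv_apply hΩ hg (1, 0)).congr
    fun _ hp => (hasDerivAt_fst_of_contDiffOn hΩ hg hp).deriv

theorem pd_zero_zero (f : ℝ → ℝ → ℝ) (t v : ℝ) : pd f 0 0 t v = f t v := by
  simp [pd]

theorem pd_zero_succ (f : ℝ → ℝ → ℝ) (j : ℕ) (t v : ℝ) :
    pd f 0 (j + 1) t v = deriv (fun w => pd f 0 j t w) v := by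
  simp [pd, iteratedDeriv_succ]

theorem pd_succ (f : ℝ → ℝ → ℝ) (i j : ℕ) (t v : ℝ) :
    pd f (i + 1) j t v = deriv (fun s => pd f i j s v) t := by
  simp only [pd, iteratedDeriv_succ]

theorem contDiffOn_pd {f : ℝ → ℝ → ℝ} {Ω : Set (ℝ × ℝ)} (hΩ : IsOpen Ω)
    (hf : ContDiffOn ℝ ∞ (fun p : ℝ × ℝ => f p.1 p.2) Ω) (i j : ℕ) :
    ContDiffOn ℝ ∞ (fun p : ℝ × ℝ => pd f i j p.1 p.2) Ω := by
  induction i with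
  | zero =>
    induction j with
    | zero => simpa only [pd_zero_zero] using hf
    | succ j ih => simpa only [pd_zero_succ] using contDiffOn_deriv_snd hΩ ih
  | succ i ih => simpa only [pd_succ] using contDiffOn_deriv_fst hΩ ih

theorem hasDerivAt_pd_fst {f : ℝ → ℝ → ℝ} {Ω : Set (ℝ × ℝ)} (hΩ : IsOpen Ω)
    (hf : ContDiffOn ℝ ∞ (fun p : ℝ × ℝ => f p.1 p.2) Ω) (i j : ℕ) {t v : ℝ}
    (h : (t, v) ∈ Ω) : HasDerivAt (fun s => pd f i j s v) (pd f (i + 1) j t v) t := by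
  rw [pd_succ]
  exact (hasDerivAt_fst_of_contDiffOn hΩ (contDiffOn_pd hΩ hf i j)
    h).differentiableAt.hasDerivAt

/-- Restricted to no `t`-derivatives because `pd` differentiates in the second variable first; more
would need symmetry of mixed partials. Expanding in the second variable before the first makes this
case enough. -/
theorem hasDerivAt_pd_snd {f : ℝ → ℝ → ℝ} {Ω : Set (ℝ × ℝ)} (hΩ : IsOpen Ω)
    (hf : ContDiffOn ℝ ∞ (fun p : ℝ × ℝ => f p.1 p.2) Ω) (j : ℕ) {t v : ℝ}
    (h : (t, v) ∈ Ω) : HasDerivAt (fun w => pd f 0 j t w) (pd f 0 (j + 1) t v) v := by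
  rw [pd_zero_succ]
  exact (hasDerivAt_snd_of_contDiffOn hΩ (contDiffOn_pd hΩ hf 0 j)
    h).differentiableAt.hasDerivAt

/-! ### Taylor's formula -/

/-- The derivative of the remainder of `G` is the remainder of the shifted sequence `G (· + 1)`, so
induction and the mean value inequality suffice. The factor `1 / n!` is given up, and `uIcc` allows
either sign of `y`. -/
theorem abs_sub_taylor_le (n : ℕ) (G : ℕ → ℝ → ℝ) (x y C : ℝ)
    (hG : ∀ k < n, ∀ z ∈ uIcc 0 y, HasDerivAt (G k) (G (k + 1) (x + z)) (x + z))
    (hC : ∀ z ∈ uIcc 0 y, |G n (x + z)| ≤ C) :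
    |G 0 (x + y) - ∑ k ∈ Finset.range n, G k x * (y ^ k / (k.factorial : ℝ))| ≤ C * |y| ^ n := by
  induction n generalizing G y with
  | zero => simpa using hC y right_mem_uIcc
  | succ n ih =>
    have hC0 : 0 ≤ C := (abs_nonneg _).trans (hC 0 left_mem_uIcc)
    set R : ℝ → ℝ := fun z => G 0 (x + z) -
      ∑ k ∈ Finset.range (n + 1), G k x * (z ^ k / (k.factorial : ℝ)) with hR
    have hsub : ∀ z ∈ uIcc 0 y, uIcc 0 z ⊆ uIcc 0 y := fun z hz =>
      uIcc_subset_uIcc left_mem_uIcc hz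
    have hder : ∀ z ∈ uIcc 0 y, HasDerivWithinAt R (G 1 (x + z) -
        ∑ k ∈ Finset.range n, G (k + 1) x * (z ^ k / (k.factorial : ℝ))) (uIcc 0 y) z := by
      intro z hz
      refine HasDerivAt.hasDerivWithinAt (HasDerivAt.sub ?_ ?_)
      · exact (hG 0 (Nat.succ_pos n) z hz).comp_const_add x z
      · simp only [Finset.sum_range_succ' _ n, pow_zero]
        suffices hs : HasDerivAt
            (fun z => ∑ k ∈ Finset.range n, G (k + 1) x * (z ^ (k + 1) / ((k + 1).factorial : ℝ)))
            (∑ k ∈ Finset.range n, G (k + 1) x * (z ^ k / (k.factorial : ℝ))) z from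
          hs.add_const _
        refine HasDerivAt.fun_sum fun k _ => ?_
        have h := ((hasDerivAt_pow (k + 1) z).div_const ((k + 1).factorial : ℝ)).const_mul
          (G (k + 1) x)
        refine h.congr_deriv ?_
        have hk : ((k.factorial : ℕ) : ℝ) ≠ 0 := by positivity
        have hk1 : ((k : ℝ) + 1) ≠ 0 := by positivity
        rw [Nat.factorial_succ]
        push_cast
        field_simp
    have hbound : ∀ z ∈ uIcc 0 y, ‖G 1 (x + z) -
        ∑ k ∈ Finset.range n, G (k + 1) x * (z ^ k / (k.factorial : ℝ))‖ ≤ C * |y| ^ n := by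
      intro z hz
      refine (ih (fun k => G (k + 1)) z
        (fun k hk w hw => hG (k + 1) (Nat.succ_lt_succ hk) w (hsub z hz hw))
        (fun w hw => hC w (hsub z hz hw))).trans ?_
      have : |z| ≤ |y| := by simpa using abs_sub_left_of_mem_uIcc hz
      gcongr
    have := (convex_uIcc 0 y).norm_image_sub_le_of_norm_hasDerivWithin_le hder hbound
      left_mem_uIcc right_mem_uIcc
    have hR0 : R 0 = 0 := by simp [hR, Finset.sum_range_succ']
    rw [hR0, sub_zero, sub_zero, Real.norm_eq_abs, Real.norm_eq_abs] at this
    calc _ = |R y| := rfl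
      _ ≤ _ := this
      _ = _ := by ring

section BigO

variable {ι : Type*} {l : Filter ι} {Ω K : Set (ℝ × ℝ)} {f : ℝ → ℝ → ℝ} {T V H S Y : ι → ℝ}

theorem isBigO_one_of_continuousOn {F : ℝ × ℝ → ℝ} (hK : IsCompact K) (hF : ContinuousOn F K)
    (hTV : ∀ᶠ i in l, (T i, V i) ∈ K) : (fun i => F (T i, V i)) =O[l] fun _ => (1 : ℝ) := by
  obtain ⟨C, hC⟩ := hK.exists_bound_of_continuousOn hF
  exact IsBigO.of_bound C (hTV.mono fun i hi => by simpa using hC _ hi)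

theorem isBigO_pd (hΩ : IsOpen Ω) (hf : ContDiffOn ℝ ∞ (fun p : ℝ × ℝ => f p.1 p.2) Ω)
    (hK : IsCompact K) (hKΩ : K ⊆ Ω) (hTV : ∀ᶠ i in l, (T i, V i) ∈ K) (j k : ℕ) :
    (fun i => pd f j k (T i) (V i)) =O[l] fun _ => (1 : ℝ) :=
  isBigO_one_of_continuousOn (F := fun p => pd f j k p.1 p.2) hK
    ((contDiffOn_pd hΩ hf j k).continuousOn.mono hKΩ) hTV

/-- A compact neighbourhood of `K` in `Ω` and a radius such that boxes of that radius around
points of `K` lie in the neighbourhood. -/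
theorem exists_compact_box (hΩ : IsOpen Ω) (hK : IsCompact K) (hKΩ : K ⊆ Ω) :
    ∃ K' ⊆ Ω, IsCompact K' ∧ ∃ δ > 0, ∀ t v s y : ℝ, (t, v) ∈ K → |s| ≤ δ → |y| ≤ δ →
      (t + s, v + y) ∈ K' := by
  obtain ⟨δ, hδ, hsub⟩ := hK.exists_cthickening_subset_open hΩ hKΩ
  refine ⟨_, hsub, hK.cthickening, δ, hδ, fun t v s y hp hs hy => ?_⟩
  refine Metric.mem_cthickening_of_dist_le _ (t, v) δ K hp ?_
  rw [Prod.dist_eq]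
  simpa [Real.dist_eq] using ⟨hs, hy⟩

theorem eventually_abs_le_of_isBigO (hH : Tendsto H l (𝓝 0)) (hS : S =O[l] H) {δ : ℝ}
    (hδ : 0 < δ) : ∀ᶠ i in l, |S i| ≤ δ := by
  have := (hS.trans_tendsto hH).abs
  rw [abs_zero] at this
  exact this.eventually (Iic_mem_nhds hδ)

theorem taylor_snd_isBigO (hΩ : IsOpen Ω)
    (hf : ContDiffOn ℝ ∞ (fun p : ℝ × ℝ => f p.1 p.2) Ω)
    (hK : IsCompact K) (hKΩ : K ⊆ Ω) (hTV : ∀ᶠ i in l, (T i, V i) ∈ K)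
    (hH : Tendsto H l (𝓝 0)) (hS : S =O[l] H) (hY : Y =O[l] H) (n : ℕ) :
    (fun i => f (T i + S i) (V i + Y i) -
      ∑ j ∈ Finset.range n, pd f 0 j (T i + S i) (V i) * (Y i ^ j / (j.factorial : ℝ)))
      =O[l] fun i => Y i ^ n := by
  -- The segment joining the base point to the perturbed point may leave `K`, so derivatives are
  -- bounded on a compact neighbourhood of it.
  obtain ⟨K', hK'Ω, hK', δ, hδ, hbox⟩ := exists_compact_box hΩ hK hKΩ
  obtain ⟨C, hC⟩ := hK'.exists_bound_of_continuousOn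
    ((contDiffOn_pd hΩ hf 0 n).continuousOn.mono hK'Ω)
  refine IsBigO.of_bound C ?_
  filter_upwards [hTV, eventually_abs_le_of_isBigO hH hS hδ, eventually_abs_le_of_isBigO hH hY hδ]
    with i hi hs hy
  have hmem : ∀ z ∈ uIcc 0 (Y i), (T i + S i, V i + z) ∈ K' := fun z hz =>
    hbox _ _ _ _ hi hs (le_trans (by simpa using abs_sub_left_of_mem_uIcc hz) hy)
  have := abs_sub_taylor_le n (fun j w => pd f 0 j (T i + S i) w) (V i) (Y i) C
    (fun k _ z hz => hasDerivAt_pd_snd hΩ hf k (hK'Ω (hmem z hz)))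
    (fun z hz => hC _ (hmem z hz))
  simpa [pd_zero_zero] using this

theorem taylor_fst_isBigO (hΩ : IsOpen Ω)
    (hf : ContDiffOn ℝ ∞ (fun p : ℝ × ℝ => f p.1 p.2) Ω)
    (hK : IsCompact K) (hKΩ : K ⊆ Ω) (hTV : ∀ᶠ i in l, (T i, V i) ∈ K)
    (hH : Tendsto H l (𝓝 0)) (hS : S =O[l] H) (j n : ℕ) :
    (fun i => pd f 0 j (T i + S i) (V i) -
      ∑ k ∈ Finset.range n, pd f k j (T i) (V i) * (S i ^ k / (k.factorial : ℝ)))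
      =O[l] fun i => S i ^ n := by
  obtain ⟨K', hK'Ω, hK', δ, hδ, hbox⟩ := exists_compact_box hΩ hK hKΩ
  obtain ⟨C, hC⟩ := hK'.exists_bound_of_continuousOn
    ((contDiffOn_pd hΩ hf n j).continuousOn.mono hK'Ω)
  refine IsBigO.of_bound C ?_
  filter_upwards [hTV, eventually_abs_le_of_isBigO hH hS hδ] with i hi hs
  have hmem : ∀ z ∈ uIcc 0 (S i), (T i + z, V i) ∈ K' := fun z hz => by
    simpa using hbox _ _ _ 0 hi (le_trans (by simpa using abs_sub_left_of_mem_uIcc hz) hs)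
      (by simpa using hδ.le)
  have := abs_sub_taylor_le n (fun k s => pd f k j s (V i)) (T i) (S i) C
    (fun k _ z hz => hasDerivAt_pd_fst hΩ hf k j (hK'Ω (hmem z hz)))
    (fun z hz => hC _ (hmem z hz))
  simpa using this

/-- The coefficient of `Y ^ j` is still evaluated at time `T + S`; expanding it to order `n - j` is
enough, since `Y ^ j = O(H ^ j)` supplies the other powers. -/
theorem taylor_isBigO (hΩ : IsOpen Ω)
    (hf : ContDiffOn ℝ ∞ (fun p : ℝ × ℝ => f p.1 p.2) Ω)
    (hK : IsCompact K) (hKΩ : K ⊆ Ω) (hTV : ∀ᶠ i in l, (T i, V i) ∈ K)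
    (hH : Tendsto H l (𝓝 0)) (hS : S =O[l] H) (hY : Y =O[l] H) (n : ℕ) :
    (fun i => f (T i + S i) (V i + Y i) - ∑ j ∈ Finset.range n,
      (∑ k ∈ Finset.range (n - j), pd f k j (T i) (V i) * (S i ^ k / (k.factorial : ℝ))) *
        (Y i ^ j / (j.factorial : ℝ))) =O[l] fun i => H i ^ n := by
  have h1 := (taylor_snd_isBigO hΩ hf hK hKΩ hTV hH hS hY n).trans (hY.pow n)
  have h2 : (fun i => ∑ j ∈ Finset.range n, (pd f 0 j (T i + S i) (V i) -
      ∑ k ∈ Finset.range (n - j), pd f k j (T i) (V i) * (S i ^ k / (k.factorial : ℝ))) *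
        (Y i ^ j / (j.factorial : ℝ))) =O[l] fun i => H i ^ n := by
    refine IsBigO.fun_sum fun j hj => ?_
    have h3 := (taylor_fst_isBigO hΩ hf hK hKΩ hTV hH hS j (n - j)).trans (hS.pow (n - j))
    have h4 : (fun i => Y i ^ j / (j.factorial : ℝ)) =O[l] fun i => H i ^ j := by
      simpa only [div_eq_inv_mul] using (hY.pow j).const_mul_left _
    refine (h3.mul h4).congr_right fun i => ?_
    rw [← pow_add, Nat.sub_add_cancel (Finset.mem_range.1 hj).le]
  refine (h1.add h2).congr_left fun i => ?_
  simp only [sub_mul, Finset.sum_sub_distrib]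
  ring

end BigO

/-! ### Expansions up to fifth order along a filter -/

/-- `F = p₀ + p₁ H + p₂ H² + p₃ H³ + p₄ H⁴ + O(H⁵)` along `l`, with bounded coefficients. -/
structure Expands {ι : Type*} (l : Filter ι) (H F p0 p1 p2 p3 p4 : ι → ℝ) : Prop where
  bdd0 : p0 =O[l] fun _ => (1 : ℝ)
  bdd1 : p1 =O[l] fun _ => (1 : ℝ)
  bdd2 : p2 =O[l] fun _ => (1 : ℝ)
  bdd3 : p3 =O[l] fun _ => (1 : ℝ)
  bdd4 : p4 =O[l] fun _ => (1 : ℝ)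
  rem : (fun i => F i - (p0 i + p1 i * H i + p2 i * H i ^ 2 + p3 i * H i ^ 3 + p4 i * H i ^ 4))
    =O[l] fun i => H i ^ 5

section Algebra

variable {ι : Type*} {l : Filter ι} {H F G : ι → ℝ}

theorem isBigO_one_mul {F G : ι → ℝ} (hF : F =O[l] fun _ => (1 : ℝ))
    (hG : G =O[l] fun _ => (1 : ℝ)) : (fun i => F i * G i) =O[l] fun _ => (1 : ℝ) := by
  simpa using hF.mul hG

theorem isBigO_one_pow {F : ι → ℝ} (hF : F =O[l] fun _ => (1 : ℝ)) (n : ℕ) :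
    (fun i => F i ^ n) =O[l] fun _ => (1 : ℝ) := by
  simpa using hF.pow n

theorem isBigO_one_const (c : ℝ) : (fun _ : ι => c) =O[l] fun _ => (1 : ℝ) :=
  isBigO_const_const c one_ne_zero l

theorem isBigO_one_poly (hH : H =O[l] fun _ => (1 : ℝ)) {p0 p1 p2 p3 p4 : ι → ℝ}
    (h0 : p0 =O[l] fun _ => (1 : ℝ)) (h1 : p1 =O[l] fun _ => (1 : ℝ))
    (h2 : p2 =O[l] fun _ => (1 : ℝ)) (h3 : p3 =O[l] fun _ => (1 : ℝ))
    (h4 : p4 =O[l] fun _ => (1 : ℝ)) :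
    (fun i => p0 i + p1 i * H i + p2 i * H i ^ 2 + p3 i * H i ^ 3 + p4 i * H i ^ 4)
      =O[l] fun _ => (1 : ℝ) :=
  (((h0.add (isBigO_one_mul h1 hH)).add (isBigO_one_mul h2 (isBigO_one_pow hH 2))).add
    (isBigO_one_mul h3 (isBigO_one_pow hH 3))).add (isBigO_one_mul h4 (isBigO_one_pow hH 4))

namespace Expands

variable {p0 p1 p2 p3 p4 q0 q1 q2 q3 q4 : ι → ℝ}

theorem of_eq (h0 : p0 =O[l] fun _ => (1 : ℝ)) (h1 : p1 =O[l] fun _ => (1 : ℝ))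
    (h2 : p2 =O[l] fun _ => (1 : ℝ)) (h3 : p3 =O[l] fun _ => (1 : ℝ))
    (h4 : p4 =O[l] fun _ => (1 : ℝ)) (hF : ∀ i, F i =
      p0 i + p1 i * H i + p2 i * H i ^ 2 + p3 i * H i ^ 3 + p4 i * H i ^ 4) :
    Expands l H F p0 p1 p2 p3 p4 :=
  ⟨h0, h1, h2, h3, h4, by simpa [hF] using isBigO_zero _ l⟩

theorem of_bounded (hF : F =O[l] fun _ => (1 : ℝ)) :
    Expands l H F F (fun _ => 0) (fun _ => 0) (fun _ => 0) (fun _ => 0) :=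
  of_eq hF (isBigO_one_const 0) (isBigO_one_const 0) (isBigO_one_const 0) (isBigO_one_const 0)
    fun i => by ring

theorem step : Expands l H H (fun _ => 0) (fun _ => 1) (fun _ => 0) (fun _ => 0) (fun _ => 0) :=
  of_eq (isBigO_one_const 0) (isBigO_one_const 1) (isBigO_one_const 0) (isBigO_one_const 0)
    (isBigO_one_const 0) fun i => by ring

theorem congr {F' q0 q1 q2 q3 q4 : ι → ℝ} (h : Expands l H F p0 p1 p2 p3 p4)
    (hF : ∀ i, F' i = F i) (h0 : ∀ i, q0 i = p0 i) (h1 : ∀ i, q1 i = p1 i)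
    (h2 : ∀ i, q2 i = p2 i) (h3 : ∀ i, q3 i = p3 i) (h4 : ∀ i, q4 i = p4 i) :
    Expands l H F' q0 q1 q2 q3 q4 := by
  obtain rfl := funext hF
  obtain rfl := funext h0
  obtain rfl := funext h1
  obtain rfl := funext h2
  obtain rfl := funext h3
  obtain rfl := funext h4
  exact h

theorem of_sub (h : Expands l H F p0 p1 p2 p3 p4)
    (hG : (fun i => G i - F i) =O[l] fun i => H i ^ 5) : Expands l H G p0 p1 p2 p3 p4 :=
  ⟨h.bdd0, h.bdd1, h.bdd2, h.bdd3, h.bdd4, (hG.add h.rem).congr_left fun i => by ring⟩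

theorem isBigO_one (hH : H =O[l] fun _ => (1 : ℝ)) (h : Expands l H F p0 p1 p2 p3 p4) :
    F =O[l] fun _ => (1 : ℝ) :=
  ((h.rem.trans (isBigO_one_pow hH 5)).add
    (isBigO_one_poly hH h.bdd0 h.bdd1 h.bdd2 h.bdd3 h.bdd4)).congr_left fun i => by ring

theorem add (hF : Expands l H F p0 p1 p2 p3 p4) (hG : Expands l H G q0 q1 q2 q3 q4) :
    Expands l H (fun i => F i + G i) (fun i => p0 i + q0 i) (fun i => p1 i + q1 i)
      (fun i => p2 i + q2 i) (fun i => p3 i + q3 i) (fun i => p4 i + q4 i) :=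
  ⟨hF.bdd0.add hG.bdd0, hF.bdd1.add hG.bdd1, hF.bdd2.add hG.bdd2, hF.bdd3.add hG.bdd3,
    hF.bdd4.add hG.bdd4, (hF.rem.add hG.rem).congr_left fun i => by ring⟩

theorem mul (hH : H =O[l] fun _ => (1 : ℝ)) (hF : Expands l H F p0 p1 p2 p3 p4)
    (hG : Expands l H G q0 q1 q2 q3 q4) :
    Expands l H (fun i => F i * G i) (fun i => p0 i * q0 i)
      (fun i => p0 i * q1 i + p1 i * q0 i) (fun i => p0 i * q2 i + p1 i * q1 i + p2 i * q0 i)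
      (fun i => p0 i * q3 i + p1 i * q2 i + p2 i * q1 i + p3 i * q0 i)
      (fun i => p0 i * q4 i + p1 i * q3 i + p2 i * q2 i + p3 i * q1 i + p4 i * q0 i) := by
  have m {A B : ι → ℝ} (hA : A =O[l] fun _ => (1 : ℝ)) (hB : B =O[l] fun _ => (1 : ℝ)) :=
    isBigO_one_mul hA hB
  obtain ⟨a0, a1, a2, a3, a4, aR⟩ := hF
  have hG1 := hG.isBigO_one hH
  have hP := isBigO_one_poly hH a0 a1 a2 a3 a4
  obtain ⟨b0, b1, b2, b3, b4, bR⟩ := hG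
  refine ⟨m a0 b0, (m a0 b1).add (m a1 b0), ((m a0 b2).add (m a1 b1)).add (m a2 b0),
    (((m a0 b3).add (m a1 b2)).add (m a2 b1)).add (m a3 b0),
    ((((m a0 b4).add (m a1 b3)).add (m a2 b2)).add (m a3 b1)).add (m a4 b0), ?_⟩
  -- With `P`, `Q` the truncations, `F G - P Q = (F - P) G + P (G - Q)`. The discarded part of `P
  -- Q`, of degrees 5 to 8, is `H ^ 5` times the polynomial bounded here.
  have r := isBigO_one_poly hH ((((m a1 b4).add (m a2 b3)).add (m a3 b2)).add (m a4 b1))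
    (((m a2 b4).add (m a3 b3)).add (m a4 b2)) ((m a3 b4).add (m a4 b3)) (m a4 b4)
    (isBigO_one_const 0)
  have e1 := aR.mul hG1
  have e2 := hP.mul bR
  have e3 := r.mul (isBigO_refl (fun i => H i ^ 5) l)
  simp only [mul_one, one_mul] at e1 e2 e3
  refine ((e1.add e2).add e3).congr_left fun i => ?_
  ring

theorem const_mul (c : ℝ) (hF : Expands l H F p0 p1 p2 p3 p4) :
    Expands l H (fun i => c * F i) (fun i => c * p0 i) (fun i => c * p1 i)
      (fun i => c * p2 i) (fun i => c * p3 i) (fun i => c * p4 i) :=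
  ⟨hF.bdd0.const_mul_left c, hF.bdd1.const_mul_left c, hF.bdd2.const_mul_left c,
    hF.bdd3.const_mul_left c, hF.bdd4.const_mul_left c,
    (hF.rem.const_mul_left c).congr_left fun i => by ring⟩

theorem isBigO_step (hH : H =O[l] fun _ => (1 : ℝ))
    (h : Expands l H F (fun _ => 0) p1 p2 p3 p4) : F =O[l] H := by
  have r := isBigO_one_poly hH h.bdd1 h.bdd2 h.bdd3 h.bdd4 (isBigO_one_const 0)
  have e1 := (isBigO_refl H l).mul r
  have e2 := (isBigO_refl H l).mul (isBigO_one_pow hH 4)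
  simp only [mul_one] at e1 e2
  refine ((h.rem.trans (e2.congr_left fun i => ?_)).add e1).congr_left fun i => ?_
  · ring
  · ring

end Expands

end Algebra

/-! ### Expansion of a composition -/

/-- Coefficient of `h⁰` in `f (t + c h, v + y₁ h + y₂ h² + ⋯)`, where `D i j` stands for
`∂ₜ^i ∂ᵤ^j f (t, v)`. -/
def comp0 (D : ℕ → ℕ → ℝ) : ℝ := D 0 0

/-- Coefficient of `h¹`, see `comp0`. -/
def comp1 (D : ℕ → ℕ → ℝ) (c y1 : ℝ) : ℝ := c * D 1 0 + D 0 1 * y1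

/-- Coefficient of `h²`, see `comp0`. -/
noncomputable def comp2 (D : ℕ → ℕ → ℝ) (c y1 y2 : ℝ) : ℝ :=
  c ^ 2 / 2 * D 2 0 + c * D 1 1 * y1 + D 0 2 * y1 ^ 2 / 2 + D 0 1 * y2

/-- Coefficient of `h³`, see `comp0`. -/
noncomputable def comp3 (D : ℕ → ℕ → ℝ) (c y1 y2 y3 : ℝ) : ℝ :=
  D 0 1 * y3 + D 0 2 * y1 * y2 + c * D 1 1 * y2 + c ^ 3 / 6 * D 3 0 + c ^ 2 / 2 * D 2 1 * y1
    + c / 2 * D 1 2 * y1 ^ 2 + D 0 3 * y1 ^ 3 / 6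

/-- Coefficient of `h⁴`, see `comp0`. -/
noncomputable def comp4 (D : ℕ → ℕ → ℝ) (c y1 y2 y3 y4 : ℝ) : ℝ :=
  D 0 1 * y4 + D 0 2 * (y1 * y3 + y2 ^ 2 / 2) + c * D 1 1 * y3 + c ^ 2 / 2 * D 2 1 * y2
    + c * D 1 2 * y1 * y2 + D 0 3 * y1 ^ 2 * y2 / 2 + c ^ 4 / 24 * D 4 0
    + c ^ 3 / 6 * D 3 1 * y1 + c ^ 2 / 4 * D 2 2 * y1 ^ 2 + c / 6 * D 1 3 * y1 ^ 3
    + D 0 4 * y1 ^ 4 / 24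

section Composition

variable {ι : Type*} {l : Filter ι} {Ω K : Set (ℝ × ℝ)} {f : ℝ → ℝ → ℝ} {T V H : ι → ℝ}

theorem Expands.comp {Y y1 y2 y3 y4 : ι → ℝ} (hΩ : IsOpen Ω)
    (hf : ContDiffOn ℝ ∞ (fun p : ℝ × ℝ => f p.1 p.2) Ω)
    (hK : IsCompact K) (hKΩ : K ⊆ Ω) (hTV : ∀ᶠ i in l, (T i, V i) ∈ K)
    (hH : Tendsto H l (𝓝 0)) (c : ℝ) (hY : Expands l H Y (fun _ => 0) y1 y2 y3 y4) :
    Expands l H (fun i => f (T i + c * H i) (V i + Y i))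
      (fun i => comp0 (fun j k => pd f j k (T i) (V i)))
      (fun i => comp1 (fun j k => pd f j k (T i) (V i)) c (y1 i))
      (fun i => comp2 (fun j k => pd f j k (T i) (V i)) c (y1 i) (y2 i))
      (fun i => comp3 (fun j k => pd f j k (T i) (V i)) c (y1 i) (y2 i) (y3 i))
      (fun i => comp4 (fun j k => pd f j k (T i) (V i)) c (y1 i) (y2 i) (y3 i) (y4 i)) := by
  have hH1 : H =O[l] fun _ => (1 : ℝ) := hH.isBigO_one ℝ
  have b (c : ℝ) (j k : ℕ) : (fun i => c * pd f j k (T i) (V i)) =O[l] fun _ => (1 : ℝ) :=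
    (isBigO_pd hΩ hf hK hKΩ hTV j k).const_mul_left c
  have z : (fun _ : ι => (0 : ℝ)) =O[l] fun _ => (1 : ℝ) := isBigO_one_const 0
  have taylor := taylor_isBigO hΩ hf hK hKΩ hTV hH ((isBigO_refl H l).const_mul_left c)
    (hY.isBigO_step hH1) 5
  -- `s0`, …, `s4` expand the coefficients of `Y ^ j`, that is `∂ᵤ^j f (T + c H, V) / j!`, each cut
  -- at degree `4 - j` because `Y ^ j` has order at least `j`.
  have s0 : Expands l H _ _ _ _ _ _ :=
    .of_eq (b 1 0 0) (b c 1 0) (b (c ^ 2 / 2) 2 0) (b (c ^ 3 / 6) 3 0) (b (c ^ 4 / 24) 4 0)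
      fun _ => rfl
  have s1 : Expands l H _ _ _ _ _ _ :=
    .of_eq (b 1 0 1) (b c 1 1) (b (c ^ 2 / 2) 2 1) (b (c ^ 3 / 6) 3 1) z fun _ => rfl
  have s2 : Expands l H _ _ _ _ _ _ :=
    .of_eq (b (1 / 2) 0 2) (b (c / 2) 1 2) (b (c ^ 2 / 4) 2 2) z z fun _ => rfl
  have s3 : Expands l H _ _ _ _ _ _ :=
    .of_eq (b (1 / 6) 0 3) (b (c / 6) 1 3) z z z fun _ => rfl
  have s4 : Expands l H _ _ _ _ _ _ := .of_eq (b (1 / 24) 0 4) z z z z fun _ => rfl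
  have hY2 := hY.mul hH1 hY
  have hY3 := hY2.mul hH1 hY
  have hY4 := hY3.mul hH1 hY
  have key := (((s0.add (s1.mul hH1 hY)).add (s2.mul hH1 hY2)).add (s3.mul hH1 hY3)).add
    (s4.mul hH1 hY4)
  refine (key.congr (F' := fun i => ∑ j ∈ Finset.range 5,
      (∑ k ∈ Finset.range (5 - j), pd f k j (T i) (V i) *
        ((c * H i) ^ k / (k.factorial : ℝ))) * (Y i ^ j / (j.factorial : ℝ)))
      ?_ ?_ ?_ ?_ ?_ ?_).of_sub taylor
  · intro i
    simp [Finset.sum_range_succ, Nat.factorial]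
    ring
  all_goals
    intro i
    simp only [comp0, comp1, comp2, comp3, comp4]
    ring

/-- Expansion of a stage `f (T + c H, (1 + e H²) (V + H S))`. -/
theorem Expands.stage {S E s0 s1 s2 s3 s4 : ι → ℝ} (hΩ : IsOpen Ω)
    (hf : ContDiffOn ℝ ∞ (fun p : ℝ × ℝ => f p.1 p.2) Ω)
    (hK : IsCompact K) (hKΩ : K ⊆ Ω) (hTV : ∀ᶠ i in l, (T i, V i) ∈ K)
    (hH : Tendsto H l (𝓝 0)) (c : ℝ) (hE : E =O[l] fun _ => (1 : ℝ))
    (hS : Expands l H S s0 s1 s2 s3 s4) :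
    Expands l H (fun i => f (T i + c * H i) ((1 + E i * H i ^ 2) * (V i + H i * S i)))
      (fun i => comp0 (fun j k => pd f j k (T i) (V i)))
      (fun i => comp1 (fun j k => pd f j k (T i) (V i)) c (s0 i))
      (fun i => comp2 (fun j k => pd f j k (T i) (V i)) c (s0 i) (s1 i + E i * V i))
      (fun i => comp3 (fun j k => pd f j k (T i) (V i)) c (s0 i) (s1 i + E i * V i)
        (s2 i + E i * s0 i))
      (fun i => comp4 (fun j k => pd f j k (T i) (V i)) c (s0 i) (s1 i + E i * V i)
        (s2 i + E i * s0 i) (s3 i + E i * s1 i)) := by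
  have hH1 : H =O[l] fun _ => (1 : ℝ) := hH.isBigO_one ℝ
  have z : (fun _ : ι => (0 : ℝ)) =O[l] fun _ => (1 : ℝ) := isBigO_one_const 0
  have hV : V =O[l] fun _ => (1 : ℝ) :=
    isBigO_one_of_continuousOn (F := fun p => p.2) hK continuous_snd.continuousOn hTV
  -- The displacement is `(1 + E H²)(V + H S) - V = E V H² + (1 + E H²) H S`, with no constant term,
  -- as `Expands.comp` requires.
  have h1 : Expands l H _ _ _ _ _ _ :=
    .of_eq (isBigO_one_const 1) z hE z z fun _ => rfl
  have h2 : Expands l H _ _ _ _ _ _ := .of_eq z z (isBigO_one_mul hE hV) z z fun _ => rfl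
  have hY := h2.add ((h1.mul hH1 Expands.step).mul hH1 hS)
  have hY' := hY.congr (F' := fun i => (1 + E i * H i ^ 2) * (V i + H i * S i) - V i)
    (q0 := fun _ => 0) (q1 := s0) (q2 := fun i => s1 i + E i * V i)
    (q3 := fun i => s2 i + E i * s0 i) (q4 := fun i => s3 i + E i * s1 i)
    (fun i => by ring) (fun i => by ring) (fun i => by ring) (fun i => by ring)
    (fun i => by ring) (fun i => by ring)
  simpa only [add_sub_cancel] using Expands.comp hΩ hf hK hKΩ hTV hH c hY'

end Composition

/-! ### The filter of small steps -/

/-- The filter of triples `(t, h, x)` with `h → 0`, `0 ≤ h`, `a ≤ t`, `t + h ≤ b`, `|x| ≤ M`. -/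
def stepFilter (a b M : ℝ) : Filter (ℝ × ℝ × ℝ) :=
  comap (fun p => p.2.1) (𝓝 0) ⊓
    𝓟 {p | a ≤ p.1 ∧ 0 ≤ p.2.1 ∧ p.1 + p.2.1 ≤ b ∧ |p.2.2| ≤ M}

section StepFilter

variable {a b M : ℝ}

theorem tendsto_step : Tendsto (fun p : ℝ × ℝ × ℝ => p.2.1) (stepFilter a b M) (𝓝 0) :=
  tendsto_comap.mono_left inf_le_left

theorem eventually_stepFilter : ∀ᶠ p in stepFilter a b M,
    a ≤ p.1 ∧ 0 ≤ p.2.1 ∧ p.1 + p.2.1 ≤ b ∧ |p.2.2| ≤ M :=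
  eventually_inf_principal.2 (Eventually.of_forall fun _ h => h)

theorem isBigO_stepFilter_iff {F : ℝ × ℝ × ℝ → ℝ} {n : ℕ} :
    (F =O[stepFilter a b M] fun p => p.2.1 ^ n) ↔ ∃ C δ : ℝ, 0 < δ ∧ ∀ t h x : ℝ,
      a ≤ t → 0 ≤ h → h ≤ δ → t + h ≤ b → |x| ≤ M → |F (t, h, x)| ≤ C * h ^ n := by
  rw [isBigO_iff]
  refine exists_congr fun C => ?_
  rw [stepFilter, eventually_inf_principal, eventually_comap, Metric.eventually_nhds_iff]
  constructor
  · rintro ⟨δ, hδ, h⟩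
    -- Halving passes from the open ball `|h| < δ` to a closed condition on `h`.
    refine ⟨δ / 2, by positivity, fun t s x ht hs hsδ hb hx => ?_⟩
    have := h (y := s) (by rw [Real.dist_eq, sub_zero, abs_of_nonneg hs]; linarith)
      (t, s, x) rfl ⟨ht, hs, hb, hx⟩
    simpa [abs_of_nonneg hs] using this
  · rintro ⟨δ, hδ, h⟩
    refine ⟨δ, hδ, fun s hs p hp hmem => ?_⟩
    subst hp
    rw [Real.dist_eq, sub_zero] at hs
    have := h p.1 p.2.1 p.2.2 hmem.1 hmem.2.1 ((le_abs_self _).trans hs.le) hmem.2.2.1 hmem.2.2.2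
    simpa [abs_of_nonneg hmem.2.1] using this

/-- Integration gains one power of `h`: the mean value inequality is applied on `[0, h]` with `t`
and `x` fixed, so the constant stays uniform. -/
theorem isBigO_of_deriv {E E' : ℝ × ℝ × ℝ → ℝ} {n : ℕ} (h0 : ∀ t x, E (t, 0, x) = 0)
    (hd : ∀ t x s, a ≤ t → 0 ≤ s → t + s ≤ b →
      HasDerivWithinAt (fun s => E (t, s, x)) (E' (t, s, x)) (Icc 0 (b - t)) s)
    (hE' : E' =O[stepFilter a b M] fun p => p.2.1 ^ n) :
    E =O[stepFilter a b M] fun p => p.2.1 ^ (n + 1) := by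
  rw [isBigO_stepFilter_iff] at hE' ⊢
  obtain ⟨C, δ, hδ, hC⟩ := hE'
  refine ⟨|C|, δ, hδ, fun t h x ht hh hhδ hb hx => ?_⟩
  have hsub : Icc 0 h ⊆ Icc 0 (b - t) := Icc_subset_Icc_right (by linarith)
  have := (convex_Icc 0 h).norm_image_sub_le_of_norm_hasDerivWithin_le (C := |C| * h ^ n)
    (f := fun s => E (t, s, x)) (f' := fun s => E' (t, s, x))
    (fun s hs => (hd t x s ht hs.1 (by linarith [hs.2])).mono hsub)
    (fun s hs => by
      have h1 := hC t s x ht hs.1 (hs.2.trans hhδ) (by linarith [hs.2]) hx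
      have h2 : s ^ n ≤ h ^ n := pow_le_pow_left₀ hs.1 hs.2 n
      have h3 : 0 ≤ s ^ n := pow_nonneg hs.1 n
      exact h1.trans (mul_le_mul (le_abs_self C) h2 h3 (abs_nonneg C)))
    (left_mem_Icc.2 hh) (right_mem_Icc.2 hh)
  simp only [h0, sub_zero, Real.norm_eq_abs, abs_of_nonneg hh] at this
  rw [pow_succ, ← mul_assoc]
  exact this

end StepFilter

/-! ### Expansion of the exact solution -/

/-- First Taylor coefficient of the solution of `u' = f (t, u)`, where `D i j` stands for
`∂ₜ^i ∂ᵤ^j f (t, u t)`. -/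
def sol1 (D : ℕ → ℕ → ℝ) : ℝ := comp0 D

/-- Second Taylor coefficient of the solution. -/
noncomputable def sol2 (D : ℕ → ℕ → ℝ) : ℝ := comp1 D 1 (sol1 D) / 2

/-- Third Taylor coefficient of the solution. -/
noncomputable def sol3 (D : ℕ → ℕ → ℝ) : ℝ := comp2 D 1 (sol1 D) (sol2 D) / 3

/-- Fourth Taylor coefficient of the solution. -/
noncomputable def sol4 (D : ℕ → ℕ → ℝ) : ℝ := comp3 D 1 (sol1 D) (sol2 D) (sol3 D) / 4

/-- Fifth Taylor coefficient of the solution. -/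
noncomputable def sol5 (D : ℕ → ℕ → ℝ) : ℝ :=
  comp4 D 1 (sol1 D) (sol2 D) (sol3 D) (sol4 D) / 5

/-- The partial derivatives of `f` along the curve `u` at time `t`. -/
noncomputable def pdAlong (f : ℝ → ℝ → ℝ) (u : ℝ → ℝ) (t : ℝ) : ℕ → ℕ → ℝ :=
  fun j k => pd f j k t (u t)

section Solution

variable {a b M : ℝ} {f : ℝ → ℝ → ℝ} {Ω : Set (ℝ × ℝ)} {u : ℝ → ℝ}

theorem isCompact_graph (hu : ContinuousOn u (Icc a b)) :
    IsCompact ((fun t => (t, u t)) '' Icc a b) :=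
  isCompact_Icc.image_of_continuousOn (continuousOn_id.prodMk hu)

theorem eventually_mem_graph : ∀ᶠ p in stepFilter a b M,
    (p.1, u p.1) ∈ (fun t => (t, u t)) '' Icc a b :=
  eventually_stepFilter.mono fun p hp => ⟨p.1, ⟨hp.1, by linarith [hp.2.1, hp.2.2.1]⟩, rfl⟩

theorem eventually_mem_graph_add : ∀ᶠ p in stepFilter a b M,
    (p.1 + p.2.1, u (p.1 + p.2.1)) ∈ (fun t => (t, u t)) '' Icc a b :=
  eventually_stepFilter.mono fun p hp =>
    ⟨p.1 + p.2.1, ⟨by linarith [hp.1, hp.2.1], hp.2.2.1⟩, rfl⟩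

theorem hasDerivWithinAt_shift (hode : ∀ t ∈ Icc a b, HasDerivWithinAt u (f t (u t)) (Icc a b) t)
    {t s : ℝ} (ht : a ≤ t) (hs : 0 ≤ s) (hb : t + s ≤ b) :
    HasDerivWithinAt (fun s => u (t + s)) (f (t + s) (u (t + s))) (Icc 0 (b - t)) s := by
  have h1 := hode (t + s) ⟨by linarith, hb⟩
  have h2 : HasDerivWithinAt (fun s => t + s) 1 (Icc 0 (b - t)) s :=
    ((hasDerivAt_id s).const_add t).hasDerivWithinAt
  have h3 : MapsTo (fun s => t + s) (Icc 0 (b - t)) (Icc a b) := fun r hr =>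
    ⟨by linarith [hr.1], by linarith [hr.2]⟩
  exact (h1.comp s h2 h3).congr_deriv (mul_one _)

/-- Each Taylor coefficient is, up to a numerical factor, a coefficient of the composition of `f`
with the earlier ones, so its boundedness is read off from `Expands.comp`. -/
theorem isBigO_sol (hΩ : IsOpen Ω) (hf : ContDiffOn ℝ ∞ (fun p : ℝ × ℝ => f p.1 p.2) Ω)
    (hu : ContinuousOn u (Icc a b)) (hgraph : ∀ t ∈ Icc a b, (t, u t) ∈ Ω) :
    (fun p => sol1 (pdAlong f u p.1)) =O[stepFilter a b M] (fun _ => (1 : ℝ)) ∧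
    (fun p => sol2 (pdAlong f u p.1)) =O[stepFilter a b M] (fun _ => (1 : ℝ)) ∧
    (fun p => sol3 (pdAlong f u p.1)) =O[stepFilter a b M] (fun _ => (1 : ℝ)) ∧
    (fun p => sol4 (pdAlong f u p.1)) =O[stepFilter a b M] (fun _ => (1 : ℝ)) ∧
    (fun p => sol5 (pdAlong f u p.1)) =O[stepFilter a b M] (fun _ => (1 : ℝ)) := by
  have z : (fun _ : ℝ × ℝ × ℝ => (0 : ℝ)) =O[stepFilter a b M] fun _ => (1 : ℝ) :=
    isBigO_one_const 0
  have d {F : ℝ × ℝ × ℝ → ℝ} (c : ℝ) (hF : F =O[stepFilter a b M] fun _ => (1 : ℝ)) :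
      (fun p => F p / c) =O[stepFilter a b M] fun _ => (1 : ℝ) := by
    simpa only [div_eq_inv_mul] using hF.const_mul_left c⁻¹
  have key {y1 y2 y3 y4 : ℝ × ℝ × ℝ → ℝ}
      (h1 : y1 =O[stepFilter a b M] fun _ => (1 : ℝ))
      (h2 : y2 =O[stepFilter a b M] fun _ => (1 : ℝ))
      (h3 : y3 =O[stepFilter a b M] fun _ => (1 : ℝ))
      (h4 : y4 =O[stepFilter a b M] fun _ => (1 : ℝ)) :=
    Expands.comp hΩ hf (isCompact_graph hu) (image_subset_iff.2 hgraph) eventually_mem_graph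
      tendsto_step 1 (.of_eq z h1 h2 h3 h4 fun _ => rfl)
  have h1 : (fun p => sol1 (pdAlong f u p.1)) =O[stepFilter a b M] fun _ => (1 : ℝ) :=
    (key z z z z).bdd0
  have h2 : (fun p => sol2 (pdAlong f u p.1)) =O[stepFilter a b M] fun _ => (1 : ℝ) :=
    d 2 (key h1 z z z).bdd1
  have h3 : (fun p => sol3 (pdAlong f u p.1)) =O[stepFilter a b M] fun _ => (1 : ℝ) :=
    d 3 (key h1 h2 z z).bdd2
  have h4 : (fun p => sol4 (pdAlong f u p.1)) =O[stepFilter a b M] fun _ => (1 : ℝ) :=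
    d 4 (key h1 h2 h3 z).bdd3
  exact ⟨h1, h2, h3, h4, d 5 (key h1 h2 h3 h4).bdd4⟩

/-- Let `P` be the Taylor polynomial and `E = u(t + h) - P(h)`. Then `E' = [f(·, u) - f(·, P)] +
[f(·, P) - P']`. The second bracket is `O(h⁵)` by the recursion defining the coefficients, and the
first is `O(E)` by the Lipschitz property. So `E = O(hⁿ)` with `n ≤ 5` improves to `E = O(hⁿ⁺¹)`,
starting from `E = O(h)`. -/
theorem solution_sub_taylor_isBigO (hΩ : IsOpen Ω)
    (hf : ContDiffOn ℝ ∞ (fun p : ℝ × ℝ => f p.1 p.2) Ω)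
    (hgraph : ∀ t ∈ Icc a b, (t, u t) ∈ Ω)
    (hode : ∀ t ∈ Icc a b, HasDerivWithinAt u (f t (u t)) (Icc a b) t) :
    (fun p => u (p.1 + p.2.1) - (u p.1 + (sol1 (pdAlong f u p.1) * p.2.1 +
      sol2 (pdAlong f u p.1) * p.2.1 ^ 2 + sol3 (pdAlong f u p.1) * p.2.1 ^ 3 +
      sol4 (pdAlong f u p.1) * p.2.1 ^ 4 + sol5 (pdAlong f u p.1) * p.2.1 ^ 5)))
      =O[stepFilter a b M] fun p => p.2.1 ^ 6 := by
  have hu : ContinuousOn u (Icc a b) := fun t ht => (hode t ht).continuousWithinAt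
  have hK := isCompact_graph hu
  have hKΩ : (fun t => (t, u t)) '' Icc a b ⊆ Ω := image_subset_iff.2 hgraph
  have hH : Tendsto (fun p : ℝ × ℝ × ℝ => p.2.1) (stepFilter a b M) (𝓝 0) := tendsto_step
  have hH1 : (fun p : ℝ × ℝ × ℝ => p.2.1) =O[stepFilter a b M] fun _ => (1 : ℝ) :=
    hH.isBigO_one ℝ
  obtain ⟨b1, b2, b3, b4, b5⟩ := isBigO_sol (M := M) hΩ hf hu hgraph
  have z : (fun _ : ℝ × ℝ × ℝ => (0 : ℝ)) =O[stepFilter a b M] fun _ => (1 : ℝ) :=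
    isBigO_one_const 0
  set Y : ℝ × ℝ × ℝ → ℝ := fun p => sol1 (pdAlong f u p.1) * p.2.1 +
      sol2 (pdAlong f u p.1) * p.2.1 ^ 2 + sol3 (pdAlong f u p.1) * p.2.1 ^ 3 +
      sol4 (pdAlong f u p.1) * p.2.1 ^ 4 + sol5 (pdAlong f u p.1) * p.2.1 ^ 5 with hY
  set E : ℝ × ℝ × ℝ → ℝ := fun p => u (p.1 + p.2.1) - (u p.1 + Y p) with hE
  set Y' : ℝ × ℝ × ℝ → ℝ := fun p => sol1 (pdAlong f u p.1) +
      2 * sol2 (pdAlong f u p.1) * p.2.1 + 3 * sol3 (pdAlong f u p.1) * p.2.1 ^ 2 +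
      4 * sol4 (pdAlong f u p.1) * p.2.1 ^ 3 + 5 * sol5 (pdAlong f u p.1) * p.2.1 ^ 4 with hY'
  -- The degree 5 term of `Y` is absorbed into the remainder.
  have expY : Expands (stepFilter a b M) (fun p => p.2.1) Y (fun _ => 0) _ _ _ _ :=
    (Expands.of_eq z b1 b2 b3 b4 fun _ => rfl).of_sub (by
      have := b5.mul (isBigO_refl (fun p : ℝ × ℝ × ℝ => p.2.1 ^ 5) (stepFilter a b M))
      simp only [one_mul] at this
      exact this.congr_left fun p => by simp only [hY]; ring)
  have hYder : (fun p => f (p.1 + p.2.1) (u p.1 + Y p) - Y' p)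
      =O[stepFilter a b M] fun p => p.2.1 ^ 5 := by
    have := (Expands.comp hΩ hf hK hKΩ eventually_mem_graph hH 1 expY).rem
    refine this.congr_left fun p => ?_
    simp only [hY', one_mul]
    change _ - (sol1 (pdAlong f u p.1) + comp1 (pdAlong f u p.1) 1 (sol1 (pdAlong f u p.1)) * _ +
      comp2 (pdAlong f u p.1) 1 _ _ * _ + comp3 (pdAlong f u p.1) 1 _ _ _ * _ +
      comp4 (pdAlong f u p.1) 1 _ _ _ _ * _) = _
    rw [sol5, sol4, sol3, sol2]
    ring
  have hder : ∀ t x s, a ≤ t → 0 ≤ s → t + s ≤ b →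
      HasDerivWithinAt (fun s => E (t, s, x))
        ((fun p : ℝ × ℝ × ℝ => f (p.1 + p.2.1) (u (p.1 + p.2.1)) - Y' p) (t, s, x))
        (Icc 0 (b - t)) s := by
    intro t x s ht hs hb
    have h (c : ℝ) (n : ℕ) := ((hasDerivAt_pow n s).const_mul c).hasDerivWithinAt (s := Icc 0 (b - t))
    have hid : HasDerivWithinAt (fun s => sol1 (pdAlong f u t) * s) (sol1 (pdAlong f u t) * 1)
      (Icc 0 (b - t)) s := ((hasDerivAt_id s).const_mul _).hasDerivWithinAt
    have hp := ((((hid.add (h (sol2 (pdAlong f u t)) 2)).add (h (sol3 (pdAlong f u t)) 3)).add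
      (h (sol4 (pdAlong f u t)) 4)).add (h (sol5 (pdAlong f u t)) 5)).const_add (u t)
    refine ((hasDerivWithinAt_shift hode ht hs hb).sub hp).congr_deriv ?_
    simp only [hY']
    push_cast
    ring
  have hE0 : ∀ t x, E (t, 0, x) = 0 := fun t x => by simp [hE, hY]
  have hinc : (fun p => u (p.1 + p.2.1) - u p.1) =O[stepFilter a b M] fun p => p.2.1 := by
    have hb1 : (fun p : ℝ × ℝ × ℝ => f (p.1 + p.2.1) (u (p.1 + p.2.1)))
        =O[stepFilter a b M] fun _ => (1 : ℝ) :=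
      isBigO_one_of_continuousOn (F := fun p => f p.1 p.2) hK (hf.continuousOn.mono hKΩ)
        eventually_mem_graph_add
    have := isBigO_of_deriv (a := a) (b := b) (M := M) (n := 0)
      (E := fun p => u (p.1 + p.2.1) - u p.1)
      (E' := fun p => f (p.1 + p.2.1) (u (p.1 + p.2.1))) (by simp)
      (fun t x s ht hs hb => (hasDerivWithinAt_shift hode ht hs hb).sub_const (u t))
      (by simpa only [pow_zero] using hb1)
    simpa using this
  have hE1 : E =O[stepFilter a b M] fun p => p.2.1 :=
    (hinc.sub (expY.isBigO_step hH1)).congr_left fun p => by simp only [hE]; ring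
  have hlip : (fun p => f (p.1 + p.2.1) (u (p.1 + p.2.1)) - f (p.1 + p.2.1) (u p.1 + Y p))
      =O[stepFilter a b M] E := by
    -- The Lipschitz estimate is the Taylor formula of order 1 based at the graph point `(t + h, u
    -- (t + h))`, with time shift `0` and displacement `-E`.
    have := taylor_snd_isBigO hΩ hf hK hKΩ eventually_mem_graph_add hH (isBigO_zero _ _)
      hE1.neg_left 1
    have := this.neg_left
    simp only [Finset.sum_range_one, pd_zero_zero, pow_zero, Nat.factorial_zero, Nat.cast_one,
      div_one, mul_one, pow_one, add_zero] at this
    refine (this.congr_left fun p => ?_).trans (isBigO_refl E _).neg_left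
    rw [show u (p.1 + p.2.1) + -E p = u p.1 + Y p by simp only [hE]; ring]
    ring
  have boot (n : ℕ) (hn : n ≤ 5) (h : E =O[stepFilter a b M] fun p => p.2.1 ^ n) :
      E =O[stepFilter a b M] fun p => p.2.1 ^ (n + 1) := by
    have h5 : (fun p : ℝ × ℝ × ℝ => p.2.1 ^ 5) =O[stepFilter a b M] fun p => p.2.1 ^ n := by
      have := (isBigO_refl (fun p : ℝ × ℝ × ℝ => p.2.1 ^ n) (stepFilter a b M)).mul
        (isBigO_one_pow hH1 (5 - n))
      simpa [← pow_add, Nat.add_sub_cancel' hn] using this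
    exact isBigO_of_deriv (E' := fun p => f (p.1 + p.2.1) (u (p.1 + p.2.1)) - Y' p) hE0 hder
      (((hlip.trans h).add (hYder.trans h5)).congr_left fun p => by ring)
  exact boot 5 le_rfl (boot 4 (by norm_num) (boot 3 (by norm_num) (boot 2 (by norm_num)
    (boot 1 (by norm_num) (by simpa using hE1)))))

end Solution

/-! ### Expansion of the increment function -/

/-- A polynomial in the step size, truncated after the fourth power. -/
structure Trunc where
  c0 : ℝ
  c1 : ℝ
  c2 : ℝ
  c3 : ℝ
  c4 : ℝ

/-- Sum of truncated polynomials. -/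
def Trunc.add (p q : Trunc) : Trunc :=
  ⟨p.c0 + q.c0, p.c1 + q.c1, p.c2 + q.c2, p.c3 + q.c3, p.c4 + q.c4⟩

/-- Scalar multiple of a truncated polynomial. -/
def Trunc.smul (c : ℝ) (p : Trunc) : Trunc :=
  ⟨c * p.c0, c * p.c1, c * p.c2, c * p.c3, c * p.c4⟩

/-- Expansion of `f (t + c h, (1 + e h²) (v + h S))`, where `D i j` stands for
`∂ₜ^i ∂ᵤ^j f (t, v)`. -/
noncomputable def stageTrunc (D : ℕ → ℕ → ℝ) (c e v : ℝ) (S : Trunc) : Trunc :=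
  ⟨comp0 D, comp1 D c S.c0, comp2 D c S.c0 (S.c1 + e * v),
    comp3 D c S.c0 (S.c1 + e * v) (S.c2 + e * S.c0),
    comp4 D c S.c0 (S.c1 + e * v) (S.c2 + e * S.c0) (S.c3 + e * S.c1)⟩

/-- Expansion of the first stage. -/
def trunc1 (D : ℕ → ℕ → ℝ) : Trunc := ⟨D 0 0, 0, 0, 0, 0⟩

/-- Expansion of the second stage. -/
noncomputable def trunc2 (A : Coeffs) (D : ℕ → ℕ → ℝ) (v x : ℝ) : Trunc :=
  stageTrunc D A.c2 (A.c2 ^ 2 / 2 * x) v ((trunc1 D).smul A.a21)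

/-- Expansion of the third stage. -/
noncomputable def trunc3 (A : Coeffs) (D : ℕ → ℕ → ℝ) (v x : ℝ) : Trunc :=
  stageTrunc D A.c3 (A.r3 * A.c3 ^ 2 / 2 * x) v
    (((trunc1 D).smul A.a31).add ((trunc2 A D v x).smul A.a32))

/-- Expansion of the fourth stage. -/
noncomputable def trunc4 (A : Coeffs) (D : ℕ → ℕ → ℝ) (v x : ℝ) : Trunc :=
  stageTrunc D A.c4 (A.r4 * A.c4 ^ 2 / 2 * x) v
    ((((trunc1 D).smul A.a41).add ((trunc2 A D v x).smul A.a42)).add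
      ((trunc3 A D v x).smul A.a43))

/-- Expansion of the increment. -/
noncomputable def truncIncrement (A : Coeffs) (D : ℕ → ℕ → ℝ) (v x : ℝ) : Trunc :=
  ((((trunc1 D).smul A.w1).add ((trunc2 A D v x).smul A.w2)).add
    ((trunc3 A D v x).smul A.w3)).add ((trunc4 A D v x).smul A.w4)

/-- `Expands` with the coefficients bundled. -/
def ExpandsTo {ι : Type*} (l : Filter ι) (H F : ι → ℝ) (P : ι → Trunc) : Prop :=
  Expands l H F (fun i => (P i).c0) (fun i => (P i).c1) (fun i => (P i).c2)
    (fun i => (P i).c3) (fun i => (P i).c4)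

theorem ExpandsTo.add {ι : Type*} {l : Filter ι} {H F G : ι → ℝ} {P Q : ι → Trunc}
    (hF : ExpandsTo l H F P) (hG : ExpandsTo l H G Q) :
    ExpandsTo l H (fun i => F i + G i) (fun i => (P i).add (Q i)) :=
  Expands.add hF hG

theorem ExpandsTo.smul {ι : Type*} {l : Filter ι} {H F : ι → ℝ} {P : ι → Trunc} (c : ℝ)
    (hF : ExpandsTo l H F P) : ExpandsTo l H (fun i => c * F i) (fun i => (P i).smul c) :=
  Expands.const_mul c hF

section Increment

variable {a b M : ℝ} {f : ℝ → ℝ → ℝ} {Ω : Set (ℝ × ℝ)} {u : ℝ → ℝ}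

theorem increment_expandsTo (A : Coeffs) (hΩ : IsOpen Ω)
    (hf : ContDiffOn ℝ ∞ (fun p : ℝ × ℝ => f p.1 p.2) Ω)
    (hu : ContinuousOn u (Icc a b)) (hgraph : ∀ t ∈ Icc a b, (t, u t) ∈ Ω) :
    ExpandsTo (stepFilter a b M) (fun p => p.2.1)
      (fun p => increment A f p.1 (u p.1) p.2.1 p.2.2)
      (fun p => truncIncrement A (pdAlong f u p.1) (u p.1) p.2.2) := by
  have hK := isCompact_graph hu
  have hKΩ : (fun t => (t, u t)) '' Icc a b ⊆ Ω := image_subset_iff.2 hgraph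
  have hx : (fun p : ℝ × ℝ × ℝ => p.2.2) =O[stepFilter a b M] fun _ => (1 : ℝ) :=
    IsBigO.of_bound M (eventually_stepFilter.mono fun p hp => by simpa using hp.2.2.2)
  have hstage (c e : ℝ) {S : ℝ × ℝ × ℝ → ℝ} {P : ℝ × ℝ × ℝ → Trunc}
      (hS : ExpandsTo (stepFilter a b M) (fun p => p.2.1) S P) :
      ExpandsTo (stepFilter a b M) (fun p => p.2.1)
        (fun p => f (p.1 + c * p.2.1) ((1 + e * p.2.2 * p.2.1 ^ 2) * (u p.1 + p.2.1 * S p)))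
        (fun p => stageTrunc (pdAlong f u p.1) c (e * p.2.2) (u p.1) (P p)) :=
    Expands.stage hΩ hf hK hKΩ eventually_mem_graph tendsto_step c (hx.const_mul_left e) hS
  have h1 : ExpandsTo (stepFilter a b M) (fun p => p.2.1)
      (fun p => K1 f p.1 (u p.1)) (fun p => trunc1 (pdAlong f u p.1)) := by
    refine (Expands.of_bounded (isBigO_pd hΩ hf hK hKΩ eventually_mem_graph 0 0)).congr
      (fun p => ?_) (fun _ => rfl) (fun _ => rfl) (fun _ => rfl) (fun _ => rfl) (fun _ => rfl)
    rw [pd_zero_zero, K1]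
  have h2 : ExpandsTo (stepFilter a b M) (fun p => p.2.1)
      (fun p => K2 A f p.1 (u p.1) p.2.1 p.2.2)
      (fun p => trunc2 A (pdAlong f u p.1) (u p.1) p.2.2) := by
    refine (hstage A.c2 (A.c2 ^ 2 / 2) (h1.smul A.a21)).congr (fun p => ?_) (fun _ => rfl)
      (fun _ => rfl) (fun _ => rfl) (fun _ => rfl) (fun _ => rfl)
    rw [K2]
    congr 2
    ring
  have h3 : ExpandsTo (stepFilter a b M) (fun p => p.2.1)
      (fun p => K3 A f p.1 (u p.1) p.2.1 p.2.2)
      (fun p => trunc3 A (pdAlong f u p.1) (u p.1) p.2.2) := by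
    refine (hstage A.c3 (A.r3 * A.c3 ^ 2 / 2) ((h1.smul A.a31).add (h2.smul A.a32))).congr
      (fun p => ?_) (fun _ => rfl) (fun _ => rfl) (fun _ => rfl) (fun _ => rfl) (fun _ => rfl)
    rw [K3]
    congr 2
    ring
  have h4 : ExpandsTo (stepFilter a b M) (fun p => p.2.1)
      (fun p => K4 A f p.1 (u p.1) p.2.1 p.2.2)
      (fun p => trunc4 A (pdAlong f u p.1) (u p.1) p.2.2) := by
    refine (hstage A.c4 (A.r4 * A.c4 ^ 2 / 2)
      (((h1.smul A.a41).add (h2.smul A.a42)).add (h3.smul A.a43))).congr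
      (fun p => ?_) (fun _ => rfl) (fun _ => rfl) (fun _ => rfl) (fun _ => rfl) (fun _ => rfl)
    rw [K4]
    congr 2
    ring
  exact (((h1.smul A.w1).add (h2.smul A.w2)).add (h3.smul A.w3)).add (h4.smul A.w4)

/-! ### The local truncation error -/

/-- The conditions for fourth order. -/
def IsFourthOrder (A : Coeffs) : Prop := ∀ (D : ℕ → ℕ → ℝ) (v x : ℝ),
  (truncIncrement A D v x).c0 = sol1 D ∧ (truncIncrement A D v x).c1 = sol2 D ∧
    (truncIncrement A D v x).c2 = sol3 D ∧ (truncIncrement A D v x).c3 = sol4 D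

/-- The coefficient of `h⁴` in the local truncation error. -/
noncomputable def errorCoeff (A : Coeffs) (D : ℕ → ℕ → ℝ) (v x : ℝ) : ℝ :=
  sol5 D - (truncIncrement A D v x).c4

theorem exists_errorCoeff_bound (A : Coeffs) (hΩ : IsOpen Ω)
    (hf : ContDiffOn ℝ ∞ (fun p : ℝ × ℝ => f p.1 p.2) Ω)
    (hu : ContinuousOn u (Icc a b)) (hgraph : ∀ t ∈ Icc a b, (t, u t) ∈ Ω) (M : ℝ) :
    ∃ C δ : ℝ, 0 < δ ∧ ∀ t h x : ℝ, a ≤ t → 0 ≤ h → h ≤ δ → t + h ≤ b → |x| ≤ M →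
      |errorCoeff A (pdAlong f u t) (u t) x| ≤ C := by
  have h1 : (fun p => errorCoeff A (pdAlong f u p.1) (u p.1) p.2.2)
      =O[stepFilter a b M] fun _ => (1 : ℝ) :=
    (isBigO_sol hΩ hf hu hgraph).2.2.2.2.sub (increment_expandsTo A hΩ hf hu hgraph).bdd4
  have h2 := (isBigO_stepFilter_iff (n := 0)).1 (by simpa only [pow_zero] using h1)
  simpa only [pow_zero, mul_one] using h2

/-- Multiplying by `h` avoids the quotient: `u(t + h) - u(t) - h * increment` is controlled up to
`O(h⁶)`, and division by `h > 0` comes last. -/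
theorem localTruncationError_sub_le {A : Coeffs} (hA : IsFourthOrder A) (hΩ : IsOpen Ω)
    (hf : ContDiffOn ℝ ∞ (fun p : ℝ × ℝ => f p.1 p.2) Ω)
    (hgraph : ∀ t ∈ Icc a b, (t, u t) ∈ Ω)
    (hode : ∀ t ∈ Icc a b, HasDerivWithinAt u (f t (u t)) (Icc a b) t) (M : ℝ) :
    ∃ C δ : ℝ, 0 < δ ∧ ∀ t h x : ℝ, a ≤ t → 0 < h → h ≤ δ → t + h ≤ b → |x| ≤ M →
      |localTruncationError A f u t h x - errorCoeff A (pdAlong f u t) (u t) x * h ^ 4|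
        ≤ C * h ^ 5 := by
  have hu : ContinuousOn u (Icc a b) := fun t ht => (hode t ht).continuousWithinAt
  have h1 := solution_sub_taylor_isBigO (M := M) hΩ hf hgraph hode
  have h2 := (isBigO_refl (fun p : ℝ × ℝ × ℝ => p.2.1) (stepFilter a b M)).mul
    (increment_expandsTo (M := M) A hΩ hf hu hgraph).rem
  have h3 : (fun p : ℝ × ℝ × ℝ => u (p.1 + p.2.1) - u p.1 -
      p.2.1 * increment A f p.1 (u p.1) p.2.1 p.2.2 -
      errorCoeff A (pdAlong f u p.1) (u p.1) p.2.2 * p.2.1 ^ 5)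
      =O[stepFilter a b M] fun p => p.2.1 ^ 6 := by
    refine (h1.sub (h2.congr_right fun p => (pow_succ' p.2.1 5).symm)).congr_left fun p => ?_
    obtain ⟨e0, e1, e2, e3⟩ := hA (pdAlong f u p.1) (u p.1) p.2.2
    rw [errorCoeff, e0, e1, e2, e3]
    ring
  obtain ⟨C, δ, hδ, hC⟩ := isBigO_stepFilter_iff.1 h3
  refine ⟨C, δ, hδ, fun t h x ht hh hhδ hb hx => ?_⟩
  have := hC t h x ht hh.le hhδ hb hx
  refine le_of_mul_le_mul_left ?_ hh
  calc h * |localTruncationError A f u t h x - errorCoeff A (pdAlong f u t) (u t) x * h ^ 4|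
      = |u (t + h) - u t - h * increment A f t (u t) h x -
          errorCoeff A (pdAlong f u t) (u t) x * h ^ 5| := by
        nth_rewrite 1 [← abs_of_pos hh]
        rw [← abs_mul, localTruncationError]
        congr 1
        field_simp
    _ ≤ C * h ^ 6 := this
    _ = h * (C * h ^ 5) := by ring

theorem hasAccuracy_five {A : Coeffs} (hA : IsFourthOrder A) (hΩ : IsOpen Ω)
    (hf : ContDiffOn ℝ ∞ (fun p : ℝ × ℝ => f p.1 p.2) Ω)
    (hgraph : ∀ t ∈ Icc a b, (t, u t) ∈ Ω)
    (hode : ∀ t ∈ Icc a b, HasDerivWithinAt u (f t (u t)) (Icc a b) t)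
    {admissible : ℝ → ℝ → Prop}
    (hadm : ∀ t ∈ Icc a b, ∀ x, admissible t x → errorCoeff A (pdAlong f u t) (u t) x = 0) :
    HasAccuracy A f u a b admissible 5 := by
  intro M
  obtain ⟨C, δ, hδ, hC⟩ := localTruncationError_sub_le hA hΩ hf hgraph hode M
  refine ⟨C, δ, hδ, fun t h x ht hh hhδ hb hx hadmx => ?_⟩
  simpa [hadm t ⟨ht, by linarith⟩ x hadmx] using hC t h x ht hh hhδ hb hx

theorem hasAccuracy_four {A : Coeffs} (hA : IsFourthOrder A) (hΩ : IsOpen Ω)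
    (hf : ContDiffOn ℝ ∞ (fun p : ℝ × ℝ => f p.1 p.2) Ω)
    (hgraph : ∀ t ∈ Icc a b, (t, u t) ∈ Ω)
    (hode : ∀ t ∈ Icc a b, HasDerivWithinAt u (f t (u t)) (Icc a b) t)
    {admissible : ℝ → ℝ → Prop} : HasAccuracy A f u a b admissible 4 := by
  intro M
  have hu : ContinuousOn u (Icc a b) := fun t ht => (hode t ht).continuousWithinAt
  obtain ⟨C, δ, hδ, hC⟩ := localTruncationError_sub_le hA hΩ hf hgraph hode M
  obtain ⟨C', δ', hδ', hC'⟩ := exists_errorCoeff_bound A hΩ hf hu hgraph M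
  -- `h ≤ δ` turns the remainder `C h⁵` into `|C| δ h⁴`; `C'` bounds the leading coefficient.
  refine ⟨|C| * δ + C', min δ δ', lt_min hδ hδ', fun t h x ht hh hhδ hb hx _ => ?_⟩
  obtain ⟨h1, h2⟩ := le_min_iff.1 hhδ
  have e1 := hC t h x ht hh h1 hb hx
  have e2 := hC' t h x ht hh.le h2 hb hx
  have e3 : C * h ^ 5 ≤ |C| * δ * h ^ 4 := by
    calc C * h ^ 5 ≤ |C| * h ^ 5 := by gcongr; exact le_abs_self C
      _ = |C| * h * h ^ 4 := by ring
      _ ≤ |C| * δ * h ^ 4 := by gcongr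
  calc |localTruncationError A f u t h x|
      = |(localTruncationError A f u t h x - errorCoeff A (pdAlong f u t) (u t) x * h ^ 4) +
          errorCoeff A (pdAlong f u t) (u t) x * h ^ 4| := by rw [sub_add_cancel]
    _ ≤ |localTruncationError A f u t h x - errorCoeff A (pdAlong f u t) (u t) x * h ^ 4| +
          |errorCoeff A (pdAlong f u t) (u t) x| * h ^ 4 := by
        refine (abs_add_le _ _).trans_eq ?_
        rw [abs_mul _ (h ^ 4), abs_of_pos (pow_pos hh 4)]
    _ ≤ |C| * δ * h ^ 4 + C' * h ^ 4 := by gcongr; exact e1.trans e3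
    _ = (|C| * δ + C') * h ^ 4 := by ring

/-- If the error were `O(h⁵)`, so would be `errorCoeff * h⁴`; dividing by `h⁴` bounds the fixed
number `|errorCoeff|` by `B h`, which tends to `0`. -/
theorem not_isBigO_localTruncationError {A : Coeffs} (hA : IsFourthOrder A) (hΩ : IsOpen Ω)
    (hf : ContDiffOn ℝ ∞ (fun p : ℝ × ℝ => f p.1 p.2) Ω)
    (hgraph : ∀ t ∈ Icc a b, (t, u t) ∈ Ω)
    (hode : ∀ t ∈ Icc a b, HasDerivWithinAt u (f t (u t)) (Icc a b) t)
    {t x : ℝ} (ht : t ∈ Ico a b) (hx : errorCoeff A (pdAlong f u t) (u t) x ≠ 0) :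
    ¬ ((fun h : ℝ => localTruncationError A f u t h x) =O[𝓝[>] 0] fun h : ℝ => h ^ 5) := by
  intro hO
  obtain ⟨C, δ, hδ, hC⟩ := localTruncationError_sub_le hA hΩ hf hgraph hode |x|
  have hsub : (fun h : ℝ => localTruncationError A f u t h x -
      errorCoeff A (pdAlong f u t) (u t) x * h ^ 4) =O[𝓝[>] 0] fun h : ℝ => h ^ 5 := by
    refine IsBigO.of_bound C ?_
    filter_upwards [Ioo_mem_nhdsGT (lt_min hδ (sub_pos.2 ht.2))] with h hh
    obtain ⟨h1, h2⟩ := lt_min_iff.1 hh.2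
    rw [Real.norm_eq_abs, Real.norm_eq_abs, abs_of_pos (pow_pos hh.1 5)]
    exact hC t h x ht.1 hh.1 h1.le (by linarith) le_rfl
  obtain ⟨B, hB⟩ := isBigO_iff.1 ((hO.sub hsub).congr_left fun h => sub_sub_cancel _ _)
  have hle : ∀ᶠ h : ℝ in 𝓝[>] 0, |errorCoeff A (pdAlong f u t) (u t) x| ≤ B * h := by
    filter_upwards [hB, self_mem_nhdsWithin] with h hh (hpos : 0 < h)
    rw [norm_mul, Real.norm_eq_abs, Real.norm_eq_abs, Real.norm_eq_abs,
      abs_of_pos (pow_pos hpos 4), abs_of_pos (pow_pos hpos 5)] at hh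
    refine le_of_mul_le_mul_right ?_ (pow_pos hpos 4)
    linarith [show B * h ^ 5 = B * h * h ^ 4 by ring]
  have hlim : Tendsto (fun h : ℝ => B * h) (𝓝[>] 0) (𝓝 0) := by
    have : Tendsto (fun h : ℝ => B * h) (𝓝 0) (𝓝 (B * 0)) := tendsto_id.const_mul B
    rw [mul_zero] at this
    exact this.mono_left nhdsWithin_le_nhds
  exact hx (abs_nonpos_iff.1 (ge_of_tendsto hlim hle))

/-! ### The two coefficient sets -/

theorem iteratedDerivWithin_two_solution (hab : a < b) (hΩ : IsOpen Ω)
    (hf : ContDiffOn ℝ ∞ (fun p : ℝ × ℝ => f p.1 p.2) Ω)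
    (hgraph : ∀ t ∈ Icc a b, (t, u t) ∈ Ω)
    (hode : ∀ t ∈ Icc a b, HasDerivWithinAt u (f t (u t)) (Icc a b) t) {t : ℝ}
    (ht : t ∈ Icc a b) :
    iteratedDerivWithin 2 u (Icc a b) t = pd f 1 0 t (u t) + pd f 0 1 t (u t) * f t (u t) := by
  have hud := uniqueDiffOn_Icc hab
  have h1 : ∀ s ∈ Icc a b, iteratedDerivWithin 1 u (Icc a b) s = f s (u s) := fun s hs => by
    rw [iteratedDerivWithin_one]
    exact (hode s hs).derivWithin (hud s hs)
  rw [iteratedDerivWithin_succ, derivWithin_congr h1 (h1 t ht)]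
  have hF : HasFDerivAt (fun p : ℝ × ℝ => f p.1 p.2)
      (fderiv ℝ (fun p : ℝ × ℝ => f p.1 p.2) (t, u t)) (t, u t) :=
    ((hf.contDiffAt (hΩ.mem_nhds (hgraph t ht))).differentiableAt (by simp)).hasFDerivAt
  have hc : HasDerivWithinAt (fun s => (s, u s)) ((1 : ℝ), f t (u t)) (Icc a b) t :=
    (hasDerivWithinAt_id t _).prodMk (hode t ht)
  have e1 : pd f 1 0 t (u t) = fderiv ℝ (fun p : ℝ × ℝ => f p.1 p.2) (t, u t) (1, 0) := by
    rw [pd_succ]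
    simp only [pd_zero_zero]
    exact (hasDerivAt_fst_of_contDiffOn hΩ hf (hgraph t ht)).deriv
  have e2 : pd f 0 1 t (u t) = fderiv ℝ (fun p : ℝ × ℝ => f p.1 p.2) (t, u t) (0, 1) := by
    rw [pd_zero_succ]
    simp only [pd_zero_zero]
    exact (hasDerivAt_snd_of_contDiffOn hΩ hf (hgraph t ht)).deriv
  have hd := (hF.comp_hasDerivWithinAt t hc).derivWithin (hud t ht)
  rw [Function.comp_def] at hd
  rw [hd, e1, e2]
  have : ((1 : ℝ), f t (u t)) = (1, 0) + f t (u t) • ((0 : ℝ), (1 : ℝ)) := by simp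
  rw [this, map_add, map_smul, smul_eq_mul, mul_comm]

end Increment

/-- The jet with partial derivatives `D`, value `v` and second derivative `w`. -/
def jetOf (D : ℕ → ℕ → ℝ) (v w : ℝ) : Jet where
  f := D 0 0
  ft := D 1 0
  fu := D 0 1
  ftt := D 2 0
  ftu := D 1 1
  fuu := D 0 2
  fttt := D 3 0
  fttu := D 2 1
  ftuu := D 1 2
  fuuu := D 0 3
  ftttt := D 4 0
  ftttu := D 3 1
  fttuu := D 2 2
  ftuuu := D 1 3
  fuuuu := D 0 4
  u := v
  u'' := w

/-- Besides the classical order conditions, `x` must drop out through `h³`. With `e_j = ε_j² c_j² /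
2` this holds because `∑ w_j e_j`, `∑ w_j c_j e_j` and `∑ w_j a_jk e_k` all vanish, for C2 as well.
-/
theorem isFourthOrder_C1 : IsFourthOrder C1 := by
  intro D v x
  simp only [truncIncrement, trunc4, trunc3, trunc2, trunc1, stageTrunc, Trunc.add, Trunc.smul,
    C1, sol4, sol3, sol2, sol1, comp3, comp2, comp1, comp0]
  generalize D 0 0 = f, D 1 0 = ft, D 0 1 = fu, D 2 0 = ftt, D 1 1 = ftu, D 0 2 = fuu,
    D 3 0 = fttt, D 2 1 = fttu, D 1 2 = ftuu, D 0 3 = fuuu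
  refine ⟨?_, ?_, ?_, ?_⟩ <;> ring

theorem isFourthOrder_C2 : IsFourthOrder C2 := by
  intro D v x
  simp only [truncIncrement, trunc4, trunc3, trunc2, trunc1, stageTrunc, Trunc.add, Trunc.smul,
    C2, sol4, sol3, sol2, sol1, comp3, comp2, comp1, comp0]
  generalize D 0 0 = f, D 1 0 = ft, D 0 1 = fu, D 2 0 = ftt, D 1 1 = ftu, D 0 2 = fuu,
    D 3 0 = fttt, D 2 1 = fttu, D 1 2 = ftuu, D 0 3 = fuuu
  refine ⟨?_, ?_, ?_, ?_⟩ <;> ring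

/-- A polynomial identity in independent `D i j`, possible once `u''` is replaced by `f_t + f_u f`.
Only the nonvanishing of the factor matters later. -/
theorem errorCoeff_C1 (D : ℕ → ℕ → ℝ) (v x : ℝ) :
    errorCoeff C1 D v x = -(1 / 39600) *
      (alpha1 (jetOf D v (D 1 0 + D 0 1 * D 0 0)) * x ^ 2 +
        beta1 (jetOf D v (D 1 0 + D 0 1 * D 0 0)) * x +
        gamma1 (jetOf D v (D 1 0 + D 0 1 * D 0 0))) := by
  simp only [errorCoeff, truncIncrement, trunc4, trunc3, trunc2, trunc1, stageTrunc, Trunc.add,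
    Trunc.smul, C1, sol5, sol4, sol3, sol2, sol1, comp4, comp3, comp2, comp1, comp0, jetOf,
    alpha1, beta1, gamma1]
  ring

theorem errorCoeff_C2 (D : ℕ → ℕ → ℝ) (v x : ℝ) :
    errorCoeff C2 D v x = -(1 / 5760) *
      (alpha2 (jetOf D v (D 1 0 + D 0 1 * D 0 0)) * x ^ 2 +
        beta2 (jetOf D v (D 1 0 + D 0 1 * D 0 0)) * x +
        gamma2 (jetOf D v (D 1 0 + D 0 1 * D 0 0))) := by
  simp only [errorCoeff, truncIncrement, trunc4, trunc3, trunc2, trunc1, stageTrunc, Trunc.add,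
    Trunc.smul, C2, sol5, sol4, sol3, sol2, sol1, comp4, comp3, comp2, comp1, comp0, jetOf,
    alpha2, beta2, gamma2]
  ring

section Roots

variable {a b : ℝ} {f : ℝ → ℝ → ℝ} {Ω : Set (ℝ × ℝ)} {u : ℝ → ℝ}

theorem jet_eq_jetOf (hab : a < b) (hΩ : IsOpen Ω)
    (hf : ContDiffOn ℝ ∞ (fun p : ℝ × ℝ => f p.1 p.2) Ω)
    (hgraph : ∀ t ∈ Icc a b, (t, u t) ∈ Ω)
    (hode : ∀ t ∈ Icc a b, HasDerivWithinAt u (f t (u t)) (Icc a b) t) {t : ℝ}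
    (ht : t ∈ Icc a b) :
    jet f u a b t = jetOf (pdAlong f u t) (u t)
      (pdAlong f u t 1 0 + pdAlong f u t 0 1 * pdAlong f u t 0 0) := by
  simp only [jet, jetOf, pdAlong, pd_zero_zero,
    iteratedDerivWithin_two_solution hab hΩ hf hgraph hode ht]

theorem isRoot1_iff (hab : a < b) (hΩ : IsOpen Ω)
    (hf : ContDiffOn ℝ ∞ (fun p : ℝ × ℝ => f p.1 p.2) Ω)
    (hgraph : ∀ t ∈ Icc a b, (t, u t) ∈ Ω)
    (hode : ∀ t ∈ Icc a b, HasDerivWithinAt u (f t (u t)) (Icc a b) t) {t : ℝ}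
    (ht : t ∈ Icc a b) (x : ℝ) :
    IsRoot1 f u a b t x ↔ errorCoeff C1 (pdAlong f u t) (u t) x = 0 := by
  rw [errorCoeff_C1, ← jet_eq_jetOf hab hΩ hf hgraph hode ht, IsRoot1,
    mul_eq_zero_iff_left (by norm_num)]

theorem isRoot2_iff (hab : a < b) (hΩ : IsOpen Ω)
    (hf : ContDiffOn ℝ ∞ (fun p : ℝ × ℝ => f p.1 p.2) Ω)
    (hgraph : ∀ t ∈ Icc a b, (t, u t) ∈ Ω)
    (hode : ∀ t ∈ Icc a b, HasDerivWithinAt u (f t (u t)) (Icc a b) t) {t : ℝ}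
    (ht : t ∈ Icc a b) (x : ℝ) :
    IsRoot2 f u a b t x ↔ errorCoeff C2 (pdAlong f u t) (u t) x = 0 := by
  rw [errorCoeff_C2, ← jet_eq_jetOf hab hΩ hf hgraph hode ht, IsRoot2,
    mul_eq_zero_iff_left (by norm_num)]

end Roots

end MQRBF

theorem mainTheorem6
    (a b : ℝ) (hab : a < b)
    (f : ℝ → ℝ → ℝ) (Ω : Set (ℝ × ℝ)) (hΩ : IsOpen Ω)
    (hf : ContDiffOn ℝ ∞ (fun p : ℝ × ℝ => f p.1 p.2) Ω)
    (u : ℝ → ℝ) (hu : ContDiffOn ℝ ∞ u (Icc a b))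
    (hgraph : ∀ t ∈ Icc a b, (t, u t) ∈ Ω)
    (hode : ∀ t ∈ Icc a b, HasDerivWithinAt u (f t (u t)) (Icc a b) t) :
    -- C1: fifth order when `ε₂²` is a root, fourth order for every `ε₂²`,
    -- and no better than fourth order when `ε₂²` is not a root
    (MQRBF.HasAccuracy MQRBF.C1 f u a b (fun t x => MQRBF.IsRoot1 f u a b t x) 5 ∧
      MQRBF.HasAccuracy MQRBF.C1 f u a b (fun _ _ => True) 4 ∧
      (∀ t ∈ Ico a b, ∀ x : ℝ, ¬ MQRBF.IsRoot1 f u a b t x →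
        ¬ ((fun h : ℝ => MQRBF.localTruncationError MQRBF.C1 f u t h x)
          =O[𝓝[>] 0] fun h : ℝ => h ^ 5))) ∧
    -- the same for C2
    (MQRBF.HasAccuracy MQRBF.C2 f u a b (fun t x => MQRBF.IsRoot2 f u a b t x) 5 ∧
      MQRBF.HasAccuracy MQRBF.C2 f u a b (fun _ _ => True) 4 ∧
      (∀ t ∈ Ico a b, ∀ x : ℝ, ¬ MQRBF.IsRoot2 f u a b t x →
        ¬ ((fun h : ℝ => MQRBF.localTruncationError MQRBF.C2 f u t h x)
          =O[𝓝[>] 0] fun h : ℝ => h ^ 5))) := by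
  open MQRBF in
  exact ⟨⟨hasAccuracy_five isFourthOrder_C1 hΩ hf hgraph hode
        fun t ht x => (isRoot1_iff hab hΩ hf hgraph hode ht x).1,
      hasAccuracy_four isFourthOrder_C1 hΩ hf hgraph hode,
      fun t ht x hx => not_isBigO_localTruncationError isFourthOrder_C1 hΩ hf hgraph hode ht
        (mt (isRoot1_iff hab hΩ hf hgraph hode (Ico_subset_Icc_self ht) x).2 hx)⟩,
    ⟨hasAccuracy_five isFourthOrder_C2 hΩ hf hgraph hode
        fun t ht x => (isRoot2_iff hab hΩ hf hgraph hode ht x).1,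
      hasAccuracy_four isFourthOrder_C2 hΩ hf hgraph hode,
      fun t ht x hx => not_isBigO_localTruncationError isFourthOrder_C2 hΩ hf hgraph hode ht
        (mt (isRoot2_iff hab hΩ hf hgraph hode (Ico_subset_Icc_self ht) x).2 hx)⟩⟩
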